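/- Let $k$ be a field, $P=k[x,y]$, $R=k[\![x,y]\!]$, and let $\tau$ be a term ordering with $x>_\tau y$. Let $\overline\tau$ be the induced local term ordering: $\mu>_{\overline\tau}\mu'$ if and only if $\deg \mu<\deg \mu'$, or $\deg \mu=\deg \mu'$ and $\mu>_\tau \mu'$. For an ideal $J\subset R$ let $\mathrm{Lt}_{\overline\tau}(J)\subset P$ be the ideal generated by the leading terms of the nonzero elements of $J$, and let $J^*\subset P$ be the initial ideal, generated by the initial forms (lowest-degree homogeneous components) of the elements of $J$. Let $t\ge 1$, $0=m_0<m_1<\dots<m_t$, and let $L=(x^t,\dots,x^{t-i}y^{m_i},\dots,y^{m_t})$ be the corresponding lex-segment ideal. Let $h_i=\dim_k (P/L)_i$ for $i\ge 0$ be its Hilbert function, $h_{-1}=0$, and let $s$ be the largest index with $h_s\neq 0$. Put $$V(L)=\{J\subset R:\mathrm{Lt}_{\overline\tau}(J)=L\},\qquad V_{\mathrm{hom}}(L)=\{J\in V(L): J=J^*R\}.$$ Let $d_j=m_j-m_{j-1}$ for $1\le j\le t$, and $u_{i,j}=m_j-m_{i-1}+i-j$ for $1\le i\le t+1$, $1\le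 j\le t$. Let $H$ be the $(t+1)\times t$ matrix with entries $y^{d_i}$ at $(i,i)$, $-x$ at $(i+1,i)$, and $0$ elsewhere. Let $\mathcal M(L)$ be the $k$-vector space of $(t+1)\times t$ matrices $N=(n_{i,j})$ over $k[y]$ with $n_{i,j}=0$ for $i\le j$, and such that for $i>j$ each nonzero entry satisfies $u_{i,j}\le \mathrm{ord}(n_{i,j})\le\deg (n_{i,j})<d_j$. Let $I_t(\cdot)$ denote the ideal generated by the $t$-minors, and let $N^*$ be obtained from $N$ by keeping in each entry $(i,j)$ only the term of degree $u_{i,j}$. 1. $V_{\mathrm{hom}}(L)$ is an affine space of dimension $$D_h=t+\sum_{i=t-1}^{s}(h_{i-1}-h_i)(h_i-h_{i+1}),$$ embedded linearly in the coordinates given by $N\mapsto I_t(H+N)$. Precisely: the subspace $\mathcal M_{\mathrm{hom}}(L)=\{N\in\mathcal M(L):N^*=N\}$ has dimension $D_h$ over $k$; the map $N\mapsto I_t(H+N)$ sends $\mathcal M(L)$ into $V(L)$ and restricts to a bijection $\mathcal M_{\mathrm{hom}}(L)\to V_{\mathrm{hom}}(L)$; and for $N\in\mathcal M(L)$ one has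 $I_t(H+N)\in V_{\mathrm{hom}}(L)$ if and only if $N\in\mathcal M_{\mathrm{hom}}(L)$. 2. For every $N\in\mathcal M(L)$ the matrix $N^*$ lies in $\mathcal M_{\mathrm{hom}}(L)$, and the initial ideal of $J=I_t(H+N)\subset R$ is $J^*=I_t(H+N^*)\subset P$. -/

import Mathlib

namespace LexCell

noncomputable section

open scoped Polynomial

/-! The variables are `x = X 0` and `y = X 1`; `P = k[x,y]` is `MvPolynomial (Fin 2) k` and
`R = k[[x,y]]` is `MvPowerSeries (Fin 2) k`. -/

/-! ### Local term orderings, leading terms, Groebner cells -/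

/-- `LocalGT τ a b` says that `x^a` is larger than `x^b` in the local term ordering (reverse-degree
ordering) induced by the term ordering `τ`. -/
def LocalGT (τ : MonomialOrder (Fin 2)) (a b : Fin 2 →₀ ℕ) : Prop :=
  a.degree < b.degree ∨ (a.degree = b.degree ∧ τ.toSyn b < τ.toSyn a)

/-- `a` is the exponent of the leading term of the power series `f` with respect to the local term
ordering induced by `τ`. -/
def IsLeadingExp {k : Type*} [Field k] (τ : MonomialOrder (Fin 2))
    (f : MvPowerSeries (Fin 2) k) (a : Fin 2 →₀ ℕ) : Prop :=
  MvPowerSeries.coeff a f ≠ 0 ∧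
    ∀ b : Fin 2 →₀ ℕ, MvPowerSeries.coeff b f ≠ 0 → b ≠ a → LocalGT τ a b

/-- The leading term ideal of `J`, a monomial ideal of `P`, generated by the leading terms of the
nonzero elements of `J`. -/
def leadingTermIdeal {k : Type*} [Field k] (τ : MonomialOrder (Fin 2))
    (J : Ideal (MvPowerSeries (Fin 2) k)) : Ideal (MvPolynomial (Fin 2) k) :=
  Ideal.span {p | ∃ f ∈ J, ∃ a : Fin 2 →₀ ℕ, IsLeadingExp τ f a ∧
    p = MvPolynomial.monomial a (MvPowerSeries.coeff a f)}

/-- The Groebner cell `V(E)` of the monomial ideal `E`. -/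
def groebnerCell {k : Type*} [Field k] (τ : MonomialOrder (Fin 2))
    (E : Ideal (MvPolynomial (Fin 2) k)) : Set (Ideal (MvPowerSeries (Fin 2) k)) :=
  {J | leadingTermIdeal τ J = E}

/-- The initial form of a power series: its homogeneous component of lowest degree (and `0` for the
zero series). As `f` has no terms of degree less than its order, truncating `f` right after the
order leaves exactly that component. -/
def initialForm {k : Type*} [Field k] (f : MvPowerSeries (Fin 2) k) : MvPolynomial (Fin 2) k :=
  MvPowerSeries.truncTotal (f.order.toNat + 1) f

/-- The initial ideal `J^*` of `J`, an ideal of `P`, generated by the initial forms of all elements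
of `J`. -/
def initialIdeal {k : Type*} [Field k] (J : Ideal (MvPowerSeries (Fin 2) k)) :
    Ideal (MvPolynomial (Fin 2) k) :=
  Ideal.span {p | ∃ f ∈ J, p = initialForm f}

/-- The homogeneous sub-cell `V_hom(E) = {J ∈ V(E) : J = J^*}`; the equality is one of ideals of
`R`, so `J^*` is extended from `P` to `R`. -/
def homCell {k : Type*} [Field k] (τ : MonomialOrder (Fin 2))
    (E : Ideal (MvPolynomial (Fin 2) k)) : Set (Ideal (MvPowerSeries (Fin 2) k)) :=
  {J | J ∈ groebnerCell τ E ∧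
    J = (initialIdeal J).map (MvPolynomial.coeToMvPowerSeries.ringHom (σ := Fin 2) (R := k))}

/-! ### Monomial ideals and their Hilbert functions -/

/-- The monomial ideal `(x^t, …, x^(t-i) y^(m_i), …, y^(m_t))`. -/
def monomialIdeal (k : Type*) [Field k] {t : ℕ} (m : Fin (t + 1) → ℕ) :
    Ideal (MvPolynomial (Fin 2) k) :=
  Ideal.span (Set.range fun i : Fin (t + 1) =>
    (MvPolynomial.X 0 ^ (t - (i : ℕ)) * MvPolynomial.X 1 ^ m i : MvPolynomial (Fin 2) k))

/-- The Hilbert function of `P / I` for a homogeneous ideal `I`: the dimension of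
`P_i / (I ∩ P_i)` for `i ≥ 0`, and `0` for `i < 0`. -/
def hilbertFunction {k : Type*} [Field k] (I : Ideal (MvPolynomial (Fin 2) k)) : ℤ → ℕ
  | Int.ofNat i => Module.finrank k
      (MvPolynomial.homogeneousSubmodule (Fin 2) k i ⧸
        (I.restrictScalars k).comap (MvPolynomial.homogeneousSubmodule (Fin 2) k i).subtype)
  | Int.negSucc _ => 0

/-! ### Hilbert-Burch matrices

Rows are indexed by `Fin (t + 1)` and columns by `Fin t`, starting from `0`: the pair `(a, b)` below
is the entry in row `i = a + 1` and column `j = b + 1` in the usual numbering from `1`. -/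

/-- `d_j = m_j - m_(j-1)`, for `j = b + 1`. -/
def diffs {t : ℕ} (m : Fin (t + 1) → ℕ) (b : Fin t) : ℕ := m b.succ - m b.castSucc

/-- The degree matrix, `u_(i,j) = m_j - m_(i-1) + i - j`. -/
def degreeMatrix {t : ℕ} (m : Fin (t + 1) → ℕ) : Matrix (Fin (t + 1)) (Fin t) ℤ :=
  Matrix.of fun a b => (m b.succ : ℤ) - m a + a - b

/-- The canonical Hilbert-Burch matrix `H`: entries `y^(d_i)` at `(i, i)`, entries `-x` at
`(i + 1, i)`, and zeros elsewhere. -/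
def hilbertBurch (k : Type*) [Field k] {t : ℕ} (m : Fin (t + 1) → ℕ) :
    Matrix (Fin (t + 1)) (Fin t) (MvPolynomial (Fin 2) k) :=
  Matrix.of fun a b =>
    if a = b.castSucc then MvPolynomial.X 1 ^ diffs m b
    else if a = b.succ then -MvPolynomial.X 0
    else 0

/-- The matrix `H + N` over `k[x,y]`, for a matrix `N` over `k[y]`. -/
def deformed {k : Type*} [Field k] {t : ℕ} (m : Fin (t + 1) → ℕ)
    (N : Matrix (Fin (t + 1)) (Fin t) k[X]) :
    Matrix (Fin (t + 1)) (Fin t) (MvPolynomial (Fin 2) k) :=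
  hilbertBurch k m + N.map (Polynomial.aeval (MvPolynomial.X 1))

/-- `I_r(M)`: the ideal generated by the `r × r` minors of `M`. -/
def minorsIdeal {A : Type*} [CommRing A] {p q : ℕ} (r : ℕ) (M : Matrix (Fin p) (Fin q) A) :
    Ideal A :=
  Ideal.span {z | ∃ (f : Fin r ↪o Fin p) (g : Fin r ↪o Fin q), z = (M.submatrix f g).det}

/-- `Φ(N) = I_t(H + N)`, an ideal of `R = k[[x,y]]`. -/
def Phi {k : Type*} [Field k] {t : ℕ} (m : Fin (t + 1) → ℕ)
    (N : Matrix (Fin (t + 1)) (Fin t) k[X]) : Ideal (MvPowerSeries (Fin 2) k) :=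
  minorsIdeal t ((deformed m N).map (MvPolynomial.coeToMvPowerSeries.ringHom (σ := Fin 2) (R := k)))

/-- The vector space `M(E)` of matrices `N` over `k[y]` with `n_(i,j) = 0` for `i ≤ j`, and with
`u_(i,j) ≤ ord n_(i,j)` and `deg n_(i,j) < d_j` for the nonzero entries with `i > j`; the bounds on
order and degree are expressed on the exponents of the terms of the entry. -/
def matrixSpace (k : Type*) [Field k] {t : ℕ} (m : Fin (t + 1) → ℕ) :
    Submodule k (Matrix (Fin (t + 1)) (Fin t) k[X]) where
  carrier := {N | (∀ a b, a ≤ Fin.castSucc b → N a b = 0) ∧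
    ∀ a b, Fin.castSucc b < a → ∀ c : ℕ, (N a b).coeff c ≠ 0 →
      degreeMatrix m a b ≤ (c : ℤ) ∧ c < diffs m b}
  zero_mem' := by simp
  add_mem' := by
    rintro N N' ⟨h1, h2⟩ ⟨h1', h2'⟩
    refine ⟨fun a b hab => by simp [h1 a b hab, h1' a b hab], fun a b hab c hc => ?_⟩
    by_cases h : (N a b).coeff c = 0
    · exact h2' a b hab c fun h' => hc (by simp [h, h'])
    · exact h2 a b hab c h
  smul_mem' := by
    rintro r N ⟨h1, h2⟩
    refine ⟨fun a b hab => by simp [h1 a b hab], fun a b hab c hc => h2 a b hab c fun h => ?_⟩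
    exact hc (by simp [h])

/-- The polynomial obtained from `p` by keeping only its term of degree `u` (it is `0` if
`u < 0`). -/
def keepDegree {k : Type*} [Field k] : ℤ → k[X] →ₗ[k] k[X]
  | Int.ofNat c => Polynomial.monomial c ∘ₗ Polynomial.lcoeff k c
  | Int.negSucc _ => 0

/-- The linear map `N ↦ N^*`, keeping only the term of degree `u_(i,j)` in the entry `(i,j)`. -/
def homPart {k : Type*} [Field k] {t : ℕ} (m : Fin (t + 1) → ℕ) :
    Matrix (Fin (t + 1)) (Fin t) k[X] →ₗ[k] Matrix (Fin (t + 1)) (Fin t) k[X] where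
  toFun N := Matrix.of fun a b => keepDegree (degreeMatrix m a b) (N a b)
  map_add' N N' := by ext a b; simp
  map_smul' r N := by ext a b; simp

/-- The subspace `M_hom(E)` of those `N ∈ M(E)` whose entry `(i,j)` has only a term of degree
`u_(i,j)`, that is, `N^* = N`. -/
def homMatrixSpace (k : Type*) [Field k] {t : ℕ} (m : Fin (t + 1) → ℕ) :
    Submodule k (Matrix (Fin (t + 1)) (Fin t) k[X]) :=
  matrixSpace k m ⊓ LinearMap.eqLocus (homPart m) LinearMap.id

end

end LexCell

namespace LexCell

noncomputable section

open scoped Polynomial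

/-! ### Order and homogeneity in `k[y][x]` -/

section Graded

variable {k : Type*} [Field k]

/-! Everything is computed in `k[y][x]`. Since `x > y`, the leading term of a series is the term of
its initial form with the highest power of `x`. Number rows and columns from the end, and let `μ i`
be the least exponent with `x^i y^(μ i) ∈ L`. The column relations among the signed maximal minors
of `H + N` show that the minor omitting row `t - i` is, up to the common sign `(-1)^t`, equal to
`y^(μ i) Q_i`, where `Q_i` is monic of degree `i` in `x` and `Q_(n+1) = x Q_n - ∑ ν_(n,j) y^(μ j - μ
n) Q_j` (`signedMinor_eq`). The same relations show that the `k[y]`-span of the `y^(μ i) Q_i` is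
stable under `x`, so `I_t(H + N)` consists of the sums `∑ c_i Q_i` with `y^(μ i) ∣ c_i`
(`mem_cellIdeal`). It is the image of `L` under the `k[y]`-linear bijection `x^i ↦ Q_i`, which keeps
the `x`-degree and the leading coefficient.

The order bounds on `N` say that `Q_n` has order `n` and that its part of degree `n` is the `Q_n` of
`N^*`. So the substitution preserves orders and acts on initial forms as the substitution of `N^*`
(`HasPart.substSeq`, `OrdGE.of_substSeq`). This yields the initial ideal and the leading term ideal.
Power series are reached by approximation with polynomials, and nothing is lost because the ideal
contains all polynomials of large order (`mem_of_toPowerSeries_mem`).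

The degree bounds make `N` a normal form determined by its ideal (`eq_of_cellIdeal_eq`); hence
`Φ(N)` is homogeneous iff `Φ(N) = Φ(N^*)` iff `N = N^*`. Surjectivity onto the homogeneous cell is a
division algorithm that rebuilds one column of `N` at a time (`exists_cellSeq_mem`).

For the dimension put `g_p = p + μ p`, which decreases weakly to `g_t = t`. In the reversed
numbering `u = g_i - g_j + 1` and `d = g_i - g_(i+1) + 1`, so for `j ≤ i` an entry is free exactly
when `g_j = g_i + 1`, or `g_j = g_i > g_(i+1)`. If `e_n` counts the `p < t` with `g_p = n`, the
first kind gives `∑ e_n e_(n+1)` and the second `t - e_t`. As `e_n = h_(n-1) - h_n` for `n ≥ t` and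
`h_(t-2) - h_(t-1) = -1`, the term `-e_t` is the summand `i = t - 1`. -/

/-- All terms `x^i y^j` of `g` have degree at least `d`. -/
def OrdGE (d : ℕ) (g : k[X][X]) : Prop := ∀ i j, i + j < d → (g.coeff i).coeff j = 0

/-- `g` is homogeneous of degree `d`. -/
def Homog (d : ℕ) (g : k[X][X]) : Prop := ∀ i j, i + j ≠ d → (g.coeff i).coeff j = 0

/-- `f` has order at least `d`, and `g` is its component of degree `d`. -/
def HasPart (d : ℕ) (f g : k[X][X]) : Prop := Homog d g ∧ OrdGE (d + 1) (f - g)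

theorem OrdGE.mono {d e : ℕ} {g : k[X][X]} (h : OrdGE d g) (hde : e ≤ d) : OrdGE e g :=
  fun i j hij => h i j (by omega)

theorem OrdGE.add {d : ℕ} {f g : k[X][X]} (hf : OrdGE d f) (hg : OrdGE d g) : OrdGE d (f + g) :=
  fun i j hij => by simp [hf i j hij, hg i j hij]

theorem OrdGE.neg {d : ℕ} {f : k[X][X]} (hf : OrdGE d f) : OrdGE d (-f) :=
  fun i j hij => by simp [hf i j hij]

theorem OrdGE.sub {d : ℕ} {f g : k[X][X]} (hf : OrdGE d f) (hg : OrdGE d g) : OrdGE d (f - g) := by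
  rw [sub_eq_add_neg]; exact hf.add hg.neg

theorem OrdGE.mul {d e : ℕ} {f g : k[X][X]} (hf : OrdGE d f) (hg : OrdGE e g) :
    OrdGE (d + e) (f * g) := by
  intro i j hij
  rw [Polynomial.coeff_mul, Polynomial.finsetSum_coeff]
  refine Finset.sum_eq_zero fun p hp => ?_
  rw [Polynomial.coeff_mul]
  refine Finset.sum_eq_zero fun q hq => ?_
  rw [Finset.HasAntidiagonal.mem_antidiagonal] at hp hq
  by_cases h : p.1 + q.1 < d
  · rw [hf _ _ h, zero_mul]
  · rw [hg p.2 q.2 (by omega), mul_zero]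

theorem Homog.add {d : ℕ} {f g : k[X][X]} (hf : Homog d f) (hg : Homog d g) : Homog d (f + g) :=
  fun i j hij => by simp [hf i j hij, hg i j hij]

theorem Homog.neg {d : ℕ} {f : k[X][X]} (hf : Homog d f) : Homog d (-f) :=
  fun i j hij => by simp [hf i j hij]

theorem Homog.sub {d : ℕ} {f g : k[X][X]} (hf : Homog d f) (hg : Homog d g) : Homog d (f - g) := by
  rw [sub_eq_add_neg]; exact hf.add hg.neg

theorem homog_zero (d : ℕ) : Homog d (0 : k[X][X]) := fun i j _ => by simp

theorem Homog.mul {d e : ℕ} {f g : k[X][X]} (hf : Homog d f) (hg : Homog e g) :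
    Homog (d + e) (f * g) := by
  intro i j hij
  rw [Polynomial.coeff_mul, Polynomial.finsetSum_coeff]
  refine Finset.sum_eq_zero fun p hp => ?_
  rw [Polynomial.coeff_mul]
  refine Finset.sum_eq_zero fun q hq => ?_
  rw [Finset.HasAntidiagonal.mem_antidiagonal] at hp hq
  by_cases h : p.1 + q.1 = d
  · rw [hg p.2 q.2 (by omega), mul_zero]
  · rw [hf _ _ h, zero_mul]

theorem Homog.ordGE {d : ℕ} {g : k[X][X]} (h : Homog d g) : OrdGE d g :=
  fun i j hij => h i j (by omega)

theorem Homog.eq_zero {d : ℕ} {g : k[X][X]} (h : Homog d g) (h' : OrdGE (d + 1) g) : g = 0 := by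
  ext i j
  by_cases hij : i + j = d
  · simp [h' i j (by omega)]
  · simp [h i j hij]

theorem homog_X : Homog 1 (Polynomial.X : k[X][X]) := by
  intro i j hij
  rw [Polynomial.coeff_X]
  split_ifs with h
  · rw [Polynomial.coeff_one, if_neg (by omega)]
  · simp

theorem homog_one : Homog 0 (1 : k[X][X]) := by
  intro i j hij
  rw [Polynomial.coeff_one]
  split_ifs with h
  · rw [Polynomial.coeff_one, if_neg (by omega)]
  · simp

theorem homog_C {d : ℕ} {c : k[X]} (h : ∀ j, j ≠ d → c.coeff j = 0) :
    Homog d (Polynomial.C c) := by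
  intro i j hij
  rw [Polynomial.coeff_C]
  split_ifs with h'
  · exact h j (by omega)
  · simp

theorem homog_C_X_pow (n : ℕ) : Homog n (Polynomial.C ((Polynomial.X : k[X]) ^ n)) :=
  homog_C fun j hj => by rw [Polynomial.coeff_X_pow, if_neg hj]

theorem ordGE_C {d : ℕ} {c : k[X]} (h : ∀ j, j < d → c.coeff j = 0) :
    OrdGE d (Polynomial.C c) := by
  intro i j hij
  rw [Polynomial.coeff_C]
  split_ifs with h'
  · exact h j (by omega)
  · simp

theorem HasPart.homog {d : ℕ} {f g : k[X][X]} (h : HasPart d f g) : Homog d g := h.1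

theorem HasPart.ordGE {d : ℕ} {f g : k[X][X]} (h : HasPart d f g) : OrdGE d f := by
  have := (h.2.mono (Nat.le_succ d)).add h.1.ordGE
  simpa using this

theorem Homog.hasPart {d : ℕ} {g : k[X][X]} (h : Homog d g) : HasPart d g g :=
  ⟨h, fun i j _ => by simp⟩

theorem OrdGE.hasPart_zero {d : ℕ} {g : k[X][X]} (h : OrdGE (d + 1) g) : HasPart d g 0 :=
  ⟨homog_zero d, by simpa using h⟩

theorem HasPart.add {d : ℕ} {f g f' g' : k[X][X]} (h : HasPart d f g) (h' : HasPart d f' g') :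
    HasPart d (f + f') (g + g') :=
  ⟨h.1.add h'.1, by rw [add_sub_add_comm]; exact h.2.add h'.2⟩

theorem HasPart.sub {d : ℕ} {f g f' g' : k[X][X]} (h : HasPart d f g) (h' : HasPart d f' g') :
    HasPart d (f - f') (g - g') :=
  ⟨h.1.sub h'.1, by rw [sub_sub_sub_comm]; exact h.2.sub h'.2⟩

theorem HasPart.sum {ι : Type*} {d : ℕ} (s : Finset ι) {f g : ι → k[X][X]}
    (h : ∀ i ∈ s, HasPart d (f i) (g i)) : HasPart d (∑ i ∈ s, f i) (∑ i ∈ s, g i) := by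
  classical
  induction s using Finset.induction_on with
  | empty => simpa using (homog_zero d).hasPart
  | insert a s ha ih =>
    rw [Finset.sum_insert ha, Finset.sum_insert ha]
    exact (h a (by simp)).add (ih fun i hi => h i (by simp [hi]))

theorem HasPart.mul {d e : ℕ} {f g f' g' : k[X][X]} (h : HasPart d f g) (h' : HasPart e f' g') :
    HasPart (d + e) (f * f') (g * g') := by
  refine ⟨h.1.mul h'.1, ?_⟩
  have : f * f' - g * g' = (f - g) * f' + g * (f' - g') := by ring
  rw [this]
  exact ((h.2.mul h'.ordGE).mono (by omega)).add ((h.1.ordGE.mul h'.2).mono (by omega))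

theorem HasPart.congr_degree {d e : ℕ} {f g : k[X][X]} (h : HasPart d f g) (hde : d = e) :
    HasPart e f g := hde ▸ h

/-- The component of degree `d` of `g`. -/
def part (d : ℕ) (g : k[X][X]) : k[X][X] :=
  ∑ i ∈ Finset.range (d + 1),
    Polynomial.monomial i (Polynomial.monomial (d - i) ((g.coeff i).coeff (d - i)))

theorem coeff_part (d : ℕ) (g : k[X][X]) (i j : ℕ) :
    ((part d g).coeff i).coeff j = if i + j = d then (g.coeff i).coeff j else 0 := by
  rw [part, Polynomial.finsetSum_coeff]
  simp only [Polynomial.coeff_monomial]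
  rw [Finset.sum_ite_eq']
  split_ifs with h1 h2 h2
  · rw [Polynomial.coeff_monomial, if_pos (by omega)]
    congr; omega
  · rw [Polynomial.coeff_monomial, if_neg (by rw [Finset.mem_range] at h1; omega)]
  · exact absurd (Finset.mem_range.2 (by omega)) h1
  · simp

theorem OrdGE.hasPart {d : ℕ} {g : k[X][X]} (h : OrdGE d g) : HasPart d g (part d g) := by
  refine ⟨fun i j hij => by rw [coeff_part, if_neg hij], fun i j hij => ?_⟩
  rw [Polynomial.coeff_sub, Polynomial.coeff_sub, coeff_part]
  split_ifs with h'
  · simp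
  · rw [h i j (by omega), sub_zero]

end Graded

/-! ### Substituting a sequence of monic polynomials -/

section Subst

open Polynomial

variable {A : Type*} [CommRing A]

/-- The `A`-linear map with `x^i ↦ Q i`. -/
def substSeq (Q : ℕ → A[X]) : A[X] →ₗ[A] A[X] :=
  Polynomial.lsum fun i => LinearMap.toSpanSingleton A A[X] (Q i)

theorem substSeq_apply (Q : ℕ → A[X]) (g : A[X]) :
    substSeq Q g = g.sum fun i c => C c * Q i := by
  simp [substSeq, Polynomial.lsum, Polynomial.smul_eq_C_mul]

theorem substSeq_eq_sum_range (Q : ℕ → A[X]) (g : A[X]) {n : ℕ} (h : g.degree < n) :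
    substSeq Q g = ∑ i ∈ Finset.range n, C (g.coeff i) * Q i := by
  rw [substSeq_apply, Polynomial.sum_def]
  refine Finset.sum_subset (fun i hi => ?_) fun i _ hi => ?_
  · by_contra hn
    rw [Finset.mem_range, not_lt] at hn
    exact (mem_support_iff.1 hi) (coeff_eq_zero_of_degree_lt (h.trans_le (by exact_mod_cast hn)))
  · rw [notMem_support_iff.1 hi]; simp

theorem substSeq_monomial (Q : ℕ → A[X]) (i : ℕ) (c : A) :
    substSeq Q (monomial i c) = C c * Q i := by
  rw [substSeq_apply, Polynomial.sum_monomial_index]; simp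

variable [IsDomain A] {Q : ℕ → A[X]}

theorem degree_C_mul_monic (hQ : ∀ i, (Q i).Monic) (hd : ∀ i, (Q i).natDegree = i) {c : A}
    (hc : c ≠ 0) (i : ℕ) : (C c * Q i).degree = i := by
  rw [degree_mul, degree_C hc, zero_add, degree_eq_natDegree (hQ i).ne_zero, hd]

theorem degree_substSeq_lt (hQ : ∀ i, (Q i).Monic) (hd : ∀ i, (Q i).natDegree = i) {g : A[X]}
    {n : ℕ} (h : g.degree < n) : (substSeq Q g).degree < n := by
  rw [substSeq_eq_sum_range Q g h]
  refine (degree_sum_le _ _).trans_lt ((Finset.sup_lt_iff (WithBot.bot_lt_coe n)).2 fun i hi => ?_)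
  by_cases hc : g.coeff i = 0
  · simp [hc]
  · rw [degree_C_mul_monic hQ hd hc]
    exact WithBot.coe_lt_coe.2 (by simpa using Finset.mem_range.1 hi)

/-- The substitution is unitriangular on the powers of `x`. Preservation of degree and leading
coefficient, and then injectivity, all follow from this shape. -/
theorem exists_substSeq_eq_lead (hQ : ∀ i, (Q i).Monic) (hd : ∀ i, (Q i).natDegree = i) {g : A[X]}
    (hg : g ≠ 0) : ∃ r : A[X], r.degree < g.natDegree ∧
      substSeq Q g = C g.leadingCoeff * Q g.natDegree + r := by
  refine ⟨substSeq Q g.eraseLead, degree_substSeq_lt hQ hd ?_, ?_⟩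
  · rw [← degree_eq_natDegree hg]; exact degree_eraseLead_lt hg
  · conv_lhs => rw [← eraseLead_add_monomial_natDegree_leadingCoeff g]
    rw [map_add, substSeq_monomial, add_comm]

theorem degree_substSeq (hQ : ∀ i, (Q i).Monic) (hd : ∀ i, (Q i).natDegree = i) (g : A[X]) :
    (substSeq Q g).degree = g.degree := by
  by_cases hg : g = 0
  · simp [hg]
  obtain ⟨r, hr, h⟩ := exists_substSeq_eq_lead hQ hd hg
  rw [h, degree_add_eq_left_of_degree_lt, degree_C_mul_monic hQ hd (by simpa using hg),
    degree_eq_natDegree hg]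
  rwa [degree_C_mul_monic hQ hd (by simpa using hg)]

theorem leadingCoeff_substSeq (hQ : ∀ i, (Q i).Monic) (hd : ∀ i, (Q i).natDegree = i) (g : A[X]) :
    (substSeq Q g).leadingCoeff = g.leadingCoeff := by
  by_cases hg : g = 0
  · simp [hg]
  obtain ⟨r, hr, h⟩ := exists_substSeq_eq_lead hQ hd hg
  rw [h, leadingCoeff_add_of_degree_lt', leadingCoeff_mul, leadingCoeff_C, (hQ _).leadingCoeff,
    mul_one]
  rwa [degree_C_mul_monic hQ hd (by simpa using hg)]

theorem substSeq_injective (hQ : ∀ i, (Q i).Monic) (hd : ∀ i, (Q i).natDegree = i) :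
    Function.Injective (substSeq Q) := by
  rw [← LinearMap.ker_eq_bot, LinearMap.ker_eq_bot']
  intro g hg
  rw [← degree_eq_bot, ← degree_substSeq hQ hd, hg, degree_zero]

theorem degree_sub_lead_lt (hQ : ∀ i, (Q i).Monic) (hd : ∀ i, (Q i).natDegree = i) {g : A[X]}
    (hg : g ≠ 0) : (g - C g.leadingCoeff * Q g.natDegree).degree < g.degree := by
  have hc : g.leadingCoeff ≠ 0 := by simpa using hg
  refine degree_sub_lt_left ?_ hg ?_
  · rw [degree_C_mul_monic hQ hd hc, degree_eq_natDegree hg]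
  · rw [leadingCoeff_mul, leadingCoeff_C, (hQ _).leadingCoeff, mul_one]

theorem substSeq_surjective (hQ : ∀ i, (Q i).Monic) (hd : ∀ i, (Q i).natDegree = i) :
    Function.Surjective (substSeq Q) := by
  suffices H : ∀ (n : ℕ) (g : A[X]), g.degree < n → ∃ l, substSeq Q l = g from
    fun g => H (g.natDegree + 1) g (degree_le_natDegree.trans_lt (by exact_mod_cast Nat.lt_succ_self _))
  intro n
  induction n with
  | zero =>
    intro g hg
    refine ⟨0, ?_⟩
    rw [map_zero, eq_comm, ← degree_eq_bot]
    exact Nat.WithBot.lt_zero_iff.1 (by simpa using hg)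
  | succ n ih =>
    intro g hg
    by_cases h0 : g = 0
    · exact ⟨0, by simp [h0]⟩
    obtain ⟨l, hl⟩ := ih (g - C g.leadingCoeff * Q g.natDegree)
      ((degree_sub_lead_lt hQ hd h0).trans_le (Order.lt_succ_iff.1 hg))
    exact ⟨l + monomial g.natDegree g.leadingCoeff, by rw [map_add, hl, substSeq_monomial]; ring⟩

end Subst

/-! ### The effect of a substitution on components -/

section SubstGraded

open Polynomial

variable {k : Type*} [Field k] {Q Q' : ℕ → k[X][X]}

/-- The part of degree `d` is computed term by term: the part of degree `d - i` of the coefficient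
of `x^i` meets the part of degree `i` of `Q i`. -/
theorem HasPart.substSeq (h : ∀ i, HasPart i (Q i) (Q' i)) {d : ℕ} {l l' : k[X][X]}
    (hl : HasPart d l l') : HasPart d (substSeq Q l) (substSeq Q' l') := by
  have hb (g : k[X][X]) (n : ℕ) (hn : g.natDegree ≤ n) : g.degree < (n + 1 : ℕ) :=
    degree_le_natDegree.trans_lt (by exact_mod_cast Nat.lt_succ_of_le hn)
  rw [substSeq_eq_sum_range Q l (hb l (max l.natDegree l'.natDegree) (le_max_left _ _)),
    substSeq_eq_sum_range Q' l' (hb l' (max l.natDegree l'.natDegree) (le_max_right _ _))]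
  refine HasPart.sum _ fun i _ => ?_
  by_cases hid : i ≤ d
  · refine (HasPart.mul (d := d - i) ⟨homog_C fun j hj => hl.1 i j (by omega), ?_⟩
      (h i)).congr_degree (by omega)
    rw [← C_sub]
    refine ordGE_C fun j hj => ?_
    have := hl.2 i j (by omega)
    simpa using this
  -- For `i > d` the factor `Q i` alone has order above `d`, so this term contributes nothing in
  -- degree `d`.
  · have h0 : l'.coeff i = 0 := by
      ext j; simpa using hl.1 i j (by omega)
    rw [h0, C_0, zero_mul]
    refine OrdGE.hasPart_zero ?_
    exact ((ordGE_C (d := 0) (by simp)).mul (h i).ordGE).mono (by omega)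

/-- No cancellation can raise the order: the lowest part of `l` goes to the lowest part of the image
under the substitution of the `Q' i`, which is injective. -/
theorem OrdGE.of_substSeq (hQ : ∀ i, (Q' i).Monic) (hd : ∀ i, (Q' i).natDegree = i)
    (h : ∀ i, HasPart i (Q i) (Q' i)) {d : ℕ} {l : k[X][X]} (hl : OrdGE d (LexCell.substSeq Q l)) :
    OrdGE d l := by
  induction d with
  | zero => intro i j hij; omega
  | succ d ih =>
    have h1 := (ih (hl.mono (Nat.le_succ d))).hasPart
    have h2 := h1.substSeq h
    have h3 : OrdGE (d + 1) (LexCell.substSeq Q' (part d l)) := by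
      simpa using hl.sub h2.2
    have h4 : part d l = 0 :=
      substSeq_injective hQ hd (by rw [h2.1.eq_zero h3, map_zero])
    simpa [h4] using h1.2

end SubstGraded

/-! ### The polynomials `Q_i` attached to a matrix, and the ideal of the `y^(μ i) Q_i` -/

section CellSeq

open Polynomial

variable {k : Type*} [Field k]

/-- The sequence `Q 0 = 1`, `Q (n + 1) = x * Q n - ∑ j ≤ n, ν n j * y ^ (μ j - μ n) * Q j`. -/
def cellSeq (μ : ℕ → ℕ) (ν : ℕ → ℕ → k[X]) : ℕ → k[X][X]
  | 0 => 1
  | n + 1 => X * cellSeq μ ν n -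
      ∑ j : Fin (n + 1), C (ν n j * X ^ (μ j - μ n)) * cellSeq μ ν j

theorem cellSeq_zero (μ : ℕ → ℕ) (ν : ℕ → ℕ → k[X]) : cellSeq μ ν 0 = 1 := by
  rw [cellSeq]

theorem cellSeq_succ (μ : ℕ → ℕ) (ν : ℕ → ℕ → k[X]) (n : ℕ) :
    cellSeq μ ν (n + 1) = X * cellSeq μ ν n -
      ∑ j ∈ Finset.range (n + 1), C (ν n j * X ^ (μ j - μ n)) * cellSeq μ ν j := by
  rw [cellSeq, ← Fin.sum_univ_eq_sum_range (fun j => C (ν n j * X ^ (μ j - μ n)) * cellSeq μ ν j)]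

/-- Only the coefficients `ν i j` with `i < n` enter up to index `n`; this permits changing `ν n`
later without disturbing earlier polynomials. -/
theorem cellSeq_congr {μ : ℕ → ℕ} {ν ν' : ℕ → ℕ → k[X]} {n : ℕ}
    (h : ∀ i < n, ∀ j ≤ i, ν i j = ν' i j) : ∀ i ≤ n, cellSeq μ ν i = cellSeq μ ν' i := by
  intro i
  induction i using Nat.strong_induction_on with
  | _ i ih =>
    intro hi
    rcases i with _ | i
    · rw [cellSeq_zero, cellSeq_zero]
    · rw [cellSeq_succ, cellSeq_succ, ih i (by omega) (by omega)]
      congr 1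
      refine Finset.sum_congr rfl fun j hj => ?_
      rw [Finset.mem_range] at hj
      rw [ih j (by omega) (by omega), h i (by omega) j (by omega)]

theorem cellSeq_monic_and_natDegree (μ : ℕ → ℕ) (ν : ℕ → ℕ → k[X]) (n : ℕ) :
    (cellSeq μ ν n).Monic ∧ (cellSeq μ ν n).natDegree = n := by
  induction n using Nat.strong_induction_on with
  | _ n ih =>
    rcases n with _ | n
    · rw [cellSeq_zero]; simp
    · have h1 : (X * cellSeq μ ν n).Monic := monic_X.mul (ih n (by omega)).1
      have h2 : (X * cellSeq μ ν n).natDegree = n + 1 := by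
        rw [natDegree_X_mul (ih n (by omega)).1.ne_zero, (ih n (by omega)).2]
      have h3 : (∑ j ∈ Finset.range (n + 1),
          C (ν n j * X ^ (μ j - μ n)) * cellSeq μ ν j).degree < (X * cellSeq μ ν n).degree := by
        rw [degree_eq_natDegree h1.ne_zero, h2]
        refine (degree_sum_le _ _).trans_lt
          ((Finset.sup_lt_iff (WithBot.bot_lt_coe (n + 1))).2 fun j hj => ?_)
        rw [Finset.mem_range] at hj
        refine lt_of_le_of_lt (b := ((j : ℕ) : WithBot ℕ)) ?_ (WithBot.coe_lt_coe.2 hj)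
        by_cases hc : ν n j * X ^ (μ j - μ n) = 0
        · rw [hc, C_0, zero_mul, degree_zero]; exact bot_le
        · rw [degree_mul, degree_C hc, zero_add, degree_eq_natDegree (ih j hj).1.ne_zero,
            (ih j hj).2]
      rw [cellSeq_succ]
      refine ⟨h1.sub_of_left h3, ?_⟩
      rw [natDegree_eq_of_degree_eq (degree_sub_eq_left_of_degree_lt h3), h2]

theorem cellSeq_monic (μ : ℕ → ℕ) (ν : ℕ → ℕ → k[X]) (n : ℕ) : (cellSeq μ ν n).Monic :=
  (cellSeq_monic_and_natDegree μ ν n).1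

theorem natDegree_cellSeq (μ : ℕ → ℕ) (ν : ℕ → ℕ → k[X]) (n : ℕ) :
    (cellSeq μ ν n).natDegree = n :=
  (cellSeq_monic_and_natDegree μ ν n).2

/-- The bounds on the orders and the degrees of the coefficients `ν i j`. -/
def Admissible (μ : ℕ → ℕ) (ν : ℕ → ℕ → k[X]) : Prop :=
  ∀ i j c, j ≤ i → (ν i j).coeff c ≠ 0 → μ i + (i + 1) ≤ c + μ j + j ∧ c + μ (i + 1) < μ i

/-- `ν'` keeps from `ν` only the terms of the lowest admissible degree. -/
def IsLowestPart (μ : ℕ → ℕ) (ν ν' : ℕ → ℕ → k[X]) : Prop :=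
  ∀ i j c, j ≤ i →
    (ν' i j).coeff c = if c + μ j + j = μ i + (i + 1) then (ν i j).coeff c else 0

/-- The lower bound in `Admissible` says that `ν n j * y^(μ j - μ n)` has order at least `n + 1 -
j`, so every summand of the recursion has order at least `n + 1`. -/
theorem hasPart_cellSeq {μ : ℕ → ℕ} (hμ : Antitone μ) {ν ν' : ℕ → ℕ → k[X]} (hν : Admissible μ ν)
    (hν' : IsLowestPart μ ν ν') (n : ℕ) : HasPart n (cellSeq μ ν n) (cellSeq μ ν' n) := by
  induction n using Nat.strong_induction_on with
  | _ n ih =>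
    rcases n with _ | n
    · rw [cellSeq_zero, cellSeq_zero]; exact homog_one.hasPart
    · rw [cellSeq_succ, cellSeq_succ]
      refine ((homog_X.hasPart.mul (ih n (by omega))).congr_degree (by omega)).sub
        (HasPart.sum _ fun j hj => ?_)
      rw [Finset.mem_range] at hj
      have hμj : μ n ≤ μ j := hμ (by omega)
      refine (HasPart.mul (d := n + 1 - j) ⟨homog_C fun c hc => ?_, ?_⟩ (ih j hj)).congr_degree
        (by omega)
      · rw [coeff_mul_X_pow']
        split_ifs with h
        · rw [hν' n j _ (by omega), if_neg (by omega)]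
        · rfl
      · rw [← C_sub]
        refine ordGE_C fun c hc => ?_
        rw [← sub_mul, coeff_mul_X_pow']
        split_ifs with h
        · rw [coeff_sub, hν' n j _ (by omega)]
          split_ifs with h'
          · rw [sub_self]
          · rw [sub_zero]
            by_contra h0
            have := (hν n j _ (by omega) h0).1
            omega
        · rfl

/-- The polynomials `∑ c_i x^i` with `c_i` divisible by `y ^ μ i`. -/
def staircase (k : Type*) [Field k] (μ : ℕ → ℕ) : Submodule k[X] k[X][X] where
  carrier := {l | ∀ i, X ^ μ i ∣ l.coeff i}
  zero_mem' := by simp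
  add_mem' := fun h h' i => by rw [coeff_add]; exact dvd_add (h i) (h' i)
  smul_mem' := fun c l h i => by rw [coeff_smul]; exact (h i).mul_left c

theorem mem_staircase {μ : ℕ → ℕ} {l : k[X][X]} :
    l ∈ staircase k μ ↔ ∀ i, X ^ μ i ∣ l.coeff i := Iff.rfl

theorem mem_staircase' {μ : ℕ → ℕ} {l : k[X][X]} :
    l ∈ staircase k μ ↔ ∀ i, ∀ j < μ i, (l.coeff i).coeff j = 0 := by
  simp_rw [mem_staircase, X_pow_dvd_iff]

theorem monomial_mem_staircase {μ : ℕ → ℕ} {i : ℕ} {c : k[X]} (h : X ^ μ i ∣ c) :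
    monomial i c ∈ staircase k μ := by
  intro j
  rw [coeff_monomial]
  split_ifs with hij
  · rwa [← hij]
  · exact dvd_zero _

theorem part_mem_staircase {μ : ℕ → ℕ} {l : k[X][X]} (hl : l ∈ staircase k μ) (d : ℕ) :
    part d l ∈ staircase k μ := by
  rw [mem_staircase'] at hl ⊢
  intro i j hj
  rw [coeff_part, hl i j hj, ite_self]

/-- The ideal of `k[y][x]` generated by `y ^ μ i * Q i` for `i ≤ t`. -/
def cellIdeal (μ : ℕ → ℕ) (ν : ℕ → ℕ → k[X]) (t : ℕ) : Ideal k[X][X] :=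
  Ideal.span {g | ∃ i ≤ t, g = C (X ^ μ i) * cellSeq μ ν i}

/-- This is the recursion multiplied by `y^(μ i)`, which absorbs the differences `μ j - μ i`. It is
a column of `H + N` read as a syzygy, and it keeps the staircase combinations stable under `x`. -/
theorem X_mul_cellSeq {μ : ℕ → ℕ} (hμ : Antitone μ) (ν : ℕ → ℕ → k[X]) (i : ℕ) :
    X * (C (X ^ μ i) * cellSeq μ ν i) = C (X ^ μ i) * cellSeq μ ν (i + 1) +
      ∑ j ∈ Finset.range (i + 1), C (ν i j * X ^ μ j) * cellSeq μ ν j := by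
  have h : ∑ j ∈ Finset.range (i + 1), C (ν i j * X ^ μ j) * cellSeq μ ν j =
      C (X ^ μ i) * ∑ j ∈ Finset.range (i + 1), C (ν i j * X ^ (μ j - μ i)) * cellSeq μ ν j := by
    rw [Finset.mul_sum]
    refine Finset.sum_congr rfl fun j hj => ?_
    rw [Finset.mem_range] at hj
    have hμj : μ i ≤ μ j := hμ (by omega)
    rw [← mul_assoc, ← C_mul, mul_left_comm, ← pow_add, Nat.add_sub_cancel' hμj]
  rw [h, cellSeq_succ]
  ring

theorem X_mul_mem_map_staircase {μ : ℕ → ℕ} (hμ : Antitone μ) (ν : ℕ → ℕ → k[X]) {w : k[X][X]}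
    (hw : w ∈ (staircase k μ).map (substSeq (cellSeq μ ν))) :
    X * w ∈ (staircase k μ).map (substSeq (cellSeq μ ν)) := by
  obtain ⟨l, hl, rfl⟩ := hw
  rw [substSeq_apply, Polynomial.sum_def, Finset.mul_sum]
  refine Submodule.sum_mem _ fun i _ => ?_
  have hgen (j : ℕ) (e : k[X]) (he : X ^ μ j ∣ e) :
      C e * cellSeq μ ν j ∈ (staircase k μ).map (substSeq (cellSeq μ ν)) :=
    ⟨monomial j e, monomial_mem_staircase he, substSeq_monomial _ _ _⟩
  obtain ⟨e, he⟩ := hl i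
  have h : X * (C (l.coeff i) * cellSeq μ ν i) =
      e • (X * (C (X ^ μ i) * cellSeq μ ν i)) := by
    rw [he, smul_eq_C_mul, C_mul]; ring
  rw [h, X_mul_cellSeq hμ]
  refine Submodule.smul_mem _ _ (Submodule.add_mem _ (hgen _ _ (pow_dvd_pow _ (hμ i.le_succ)))
    (Submodule.sum_mem _ fun j _ => hgen _ _ (dvd_mul_left _ _)))

theorem mul_mem_map_staircase {μ : ℕ → ℕ} (hμ : Antitone μ) (ν : ℕ → ℕ → k[X]) {w : k[X][X]}
    (hw : w ∈ (staircase k μ).map (substSeq (cellSeq μ ν))) (a : k[X][X]) :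
    a * w ∈ (staircase k μ).map (substSeq (cellSeq μ ν)) := by
  induction a using Polynomial.induction_on' with
  | add p q hp hq => rw [add_mul]; exact Submodule.add_mem _ hp hq
  | monomial n a =>
    rw [← C_mul_X_pow_eq_monomial, mul_assoc, ← smul_eq_C_mul]
    refine Submodule.smul_mem _ _ ?_
    induction n with
    | zero => simpa using hw
    | succ n ih => rw [pow_succ', mul_assoc]; exact X_mul_mem_map_staircase hμ ν ih

theorem Admissible.eq_zero {μ : ℕ → ℕ} {ν : ℕ → ℕ → k[X]} (hν : Admissible μ ν) {i j : ℕ}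
    (hj : j ≤ i) (hi : μ i = 0) : ν i j = 0 := by
  ext c
  by_contra h
  have := hν i j c hj h
  omega

/-- For `i ≥ t` the degree bound forces `ν i j = 0`, so `Q_(i+1) = x Q_i` and the further generators
are multiples of the one at `t`. -/
theorem generator_mem_cellIdeal {μ : ℕ → ℕ} {t : ℕ} (ht : ∀ i, t ≤ i → μ i = 0) {ν : ℕ → ℕ → k[X]}
    (hν : Admissible μ ν) (i : ℕ) : C (X ^ μ i) * cellSeq μ ν i ∈ cellIdeal μ ν t := by
  induction i with
  | zero => exact Ideal.subset_span ⟨0, Nat.zero_le t, rfl⟩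
  | succ i ih =>
    by_cases hi : i + 1 ≤ t
    · exact Ideal.subset_span ⟨_, hi, rfl⟩
    · rw [cellSeq_succ, Finset.sum_eq_zero fun j hj => by
        rw [hν.eq_zero (by simpa using Nat.lt_succ_iff.1 (Finset.mem_range.1 hj)) (ht i (by omega)),
          zero_mul, C_0, zero_mul], sub_zero, ht (i + 1) (by omega)]
      rw [ht i (by omega)] at ih
      rw [mul_left_comm]
      exact Ideal.mul_mem_left _ _ ih

/-- The image of the staircase is a `k[y]`-module stable under `x`, hence an ideal, and it contains
the generators. -/
theorem mem_cellIdeal {μ : ℕ → ℕ} (hμ : Antitone μ) {t : ℕ} (ht : ∀ i, t ≤ i → μ i = 0)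
    {ν : ℕ → ℕ → k[X]} (hν : Admissible μ ν) {g : k[X][X]} :
    g ∈ cellIdeal μ ν t ↔ ∃ l ∈ staircase k μ, substSeq (cellSeq μ ν) l = g := by
  constructor
  · intro hg
    refine Submodule.span_induction (p := fun g _ => g ∈ (staircase k μ).map (substSeq (cellSeq μ ν)))
      ?_ (Submodule.zero_mem _) (fun _ _ _ _ h h' => Submodule.add_mem _ h h')
      (fun a _ _ h => mul_mem_map_staircase hμ ν h a) hg
    rintro _ ⟨i, -, rfl⟩
    exact ⟨monomial i (X ^ μ i), monomial_mem_staircase dvd_rfl, substSeq_monomial _ _ _⟩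
  · rintro ⟨l, hl, rfl⟩
    rw [substSeq_apply, Polynomial.sum_def]
    refine Ideal.sum_mem _ fun i _ => ?_
    obtain ⟨e, he⟩ := hl i
    rw [he, mul_comm (X ^ μ i) e, C_mul, mul_assoc]
    exact Ideal.mul_mem_left _ _ (generator_mem_cellIdeal ht hν i)

theorem Admissible.lowestPart {μ : ℕ → ℕ} {ν ν' : ℕ → ℕ → k[X]} (hν : Admissible μ ν)
    (h : IsLowestPart μ ν ν') : Admissible μ ν' := by
  intro i j c hj hc
  rw [h i j c hj] at hc
  split_ifs at hc
  · exact hν i j c hj hc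
  · exact absurd rfl hc

theorem exists_lowestPart (μ : ℕ → ℕ) (ν : ℕ → ℕ → k[X]) : ∃ ν', IsLowestPart μ ν ν' := by
  refine ⟨fun i j => if μ j + j ≤ μ i + (i + 1) then
    monomial (μ i + (i + 1) - (μ j + j)) ((ν i j).coeff (μ i + (i + 1) - (μ j + j))) else 0,
    fun i j c hj => ?_⟩
  beta_reduce
  by_cases h : μ j + j ≤ μ i + (i + 1)
  · rw [if_pos h, coeff_monomial]
    by_cases h' : c + μ j + j = μ i + (i + 1)
    · rw [if_pos (by omega), if_pos h']; congr; omega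
    · rw [if_neg (by omega), if_neg h']
  · rw [if_neg h, if_neg (by omega), coeff_zero]

theorem OrdGE.of_substSeq_cellSeq {μ : ℕ → ℕ} (hμ : Antitone μ) {ν : ℕ → ℕ → k[X]}
    (hν : Admissible μ ν) {d : ℕ} {l : k[X][X]} (hl : OrdGE d (LexCell.substSeq (cellSeq μ ν) l)) :
    OrdGE d l := by
  obtain ⟨ν', hν'⟩ := exists_lowestPart μ ν
  exact hl.of_substSeq (cellSeq_monic μ ν') (natDegree_cellSeq μ ν') (hasPart_cellSeq hμ hν hν')

theorem OrdGE.mem_cellIdeal {μ : ℕ → ℕ} (hμ : Antitone μ) {t : ℕ} (ht : ∀ i, t ≤ i → μ i = 0)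
    {ν : ℕ → ℕ → k[X]} (hν : Admissible μ ν) {g : k[X][X]} (hg : OrdGE (t + μ 0) g) :
    g ∈ cellIdeal μ ν t := by
  obtain ⟨l, rfl⟩ := substSeq_surjective (cellSeq_monic μ ν) (natDegree_cellSeq μ ν) g
  refine (LexCell.mem_cellIdeal hμ ht hν).2 ⟨l, mem_staircase'.2 fun i j hj => ?_, rfl⟩
  -- Monomials outside the staircase have `i < t` and `j < μ i ≤ μ 0`, hence degree below `t + μ 0`.
  refine hg.of_substSeq_cellSeq hμ hν i j ?_
  have h1 : μ i ≤ μ 0 := hμ (Nat.zero_le i)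
  have h2 : i < t := by
    by_contra h
    have := ht i (by omega)
    omega
  omega

theorem exists_homog_of_mem_cellIdeal {μ : ℕ → ℕ} (hμ : Antitone μ) {t : ℕ}
    (ht : ∀ i, t ≤ i → μ i = 0) {ν ν' : ℕ → ℕ → k[X]} (hν : Admissible μ ν)
    (hν' : IsLowestPart μ ν ν') {g : k[X][X]} (hg : g ∈ cellIdeal μ ν t) {d : ℕ} (hd : OrdGE d g) :
    ∃ l ∈ staircase k μ, HasPart d g (substSeq (cellSeq μ ν') l) := by
  obtain ⟨l, hl, rfl⟩ := (LexCell.mem_cellIdeal hμ ht hν).1 hg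
  exact ⟨part d l, part_mem_staircase hl d,
    (hd.of_substSeq_cellSeq hμ hν).hasPart.substSeq (hasPart_cellSeq hμ hν hν')⟩

/-- By induction the two sequences agree up to `i`. The difference of the two generators at `i + 1`
then has `Q_j`-coordinate `y^(μ (i+1) + μ j - μ i)` times the difference of the coefficients.
Membership makes it divisible by `y^(μ j)`, while that difference has degree below `μ i - μ (i+1)`.
-/
theorem eq_of_cellIdeal_eq {μ : ℕ → ℕ} (hμ : Antitone μ) {t : ℕ}
    (ht : ∀ i, t ≤ i → μ i = 0) {ν ν' : ℕ → ℕ → k[X]} (hν : Admissible μ ν)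
    (hν' : Admissible μ ν') (h : cellIdeal μ ν t = cellIdeal μ ν' t) (i : ℕ) :
    ∀ j ≤ i, ν i j = ν' i j := by
  induction i using Nat.strong_induction_on with
  | _ i ih =>
    have hQ := cellSeq_congr (μ := μ) ih
    have hmem : C (X ^ μ (i + 1)) * cellSeq μ ν (i + 1) -
        C (X ^ μ (i + 1)) * cellSeq μ ν' (i + 1) ∈ cellIdeal μ ν t :=
      Ideal.sub_mem _ (generator_mem_cellIdeal ht hν _)
        (h ▸ generator_mem_cellIdeal ht hν' _)
    obtain ⟨l, hl, hl'⟩ := (LexCell.mem_cellIdeal hμ ht hν).1 hmem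
    have hsum : C (X ^ μ (i + 1)) * cellSeq μ ν (i + 1) -
        C (X ^ μ (i + 1)) * cellSeq μ ν' (i + 1) = substSeq (cellSeq μ ν)
          (∑ j ∈ Finset.range (i + 1),
            monomial j (X ^ μ (i + 1) * (X ^ (μ j - μ i) * (ν' i j - ν i j)))) := by
      rw [cellSeq_succ, cellSeq_succ, hQ i le_rfl, map_sum, ← mul_sub, sub_sub_sub_cancel_left,
        ← Finset.sum_sub_distrib, Finset.mul_sum]
      refine Finset.sum_congr rfl fun j hj => ?_
      rw [substSeq_monomial, hQ j (Nat.lt_succ_iff.1 (Finset.mem_range.1 hj))]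
      simp only [C_mul, C_sub]
      ring
    rw [← hl'] at hsum
    have hl0 := substSeq_injective (cellSeq_monic μ ν) (natDegree_cellSeq μ ν) hsum
    intro j hj
    have hμj : μ i ≤ μ j := hμ hj
    have hμi : μ (i + 1) ≤ μ i := hμ i.le_succ
    have hdvd := hl j
    rw [hl0, finsetSum_coeff] at hdvd
    simp only [coeff_monomial] at hdvd
    rw [Finset.sum_ite_eq' , if_pos (Finset.mem_range.2 (by omega)), ← mul_assoc, ← pow_add,
      X_pow_dvd_iff] at hdvd
    ext c
    by_cases hc : c + μ (i + 1) < μ i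
    · have := hdvd (c + (μ (i + 1) + (μ j - μ i))) (by omega)
      rw [coeff_X_pow_mul, coeff_sub, sub_eq_zero] at this
      exact this.symm
    · rw [not_ne_iff.1 fun h0 => hc (hν i j c hj h0).2,
        not_ne_iff.1 fun h0 => hc (hν' i j c hj h0).2]

end CellSeq

/-! ### Recovering the coefficients `ν` from an ideal with homogeneous generators -/

section Existence

open Polynomial

variable {k : Type*} [Field k]

/-- Division by the `Q_i` from the top `x`-degree down: `hlead` makes each leading coefficient
divisible by the right power of `y`, so the subtracted multiple lies in `I`. Only indices below `n`
are assumed, since the construction below knows no others yet. -/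
theorem exists_staircase_of_mem {μ : ℕ → ℕ} {ν : ℕ → ℕ → k[X]}
    (hQ : ∀ i, Homog i (cellSeq μ ν i)) {I : Ideal k[X][X]}
    (hlead : ∀ g ∈ I, ∀ d, Homog d g → g ≠ 0 → X ^ μ g.natDegree ∣ g.leadingCoeff) (d n : ℕ)
    (hI : ∀ i < n, C (X ^ μ i) * cellSeq μ ν i ∈ I) {g : k[X][X]} (hg : g ∈ I) (hgd : Homog d g)
    (hgn : g.degree < n) :
    ∃ l ∈ staircase k μ, Homog d l ∧ l.degree < n ∧ substSeq (cellSeq μ ν) l = g := by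
  induction n generalizing g with
  | zero =>
    have hg0 : g = 0 := by
      rw [← degree_eq_bot]; exact Nat.WithBot.lt_zero_iff.1 (by simpa using hgn)
    exact ⟨0, Submodule.zero_mem _, homog_zero d, by simp, by simp [hg0]⟩
  | succ n ih =>
    by_cases h0 : g = 0
    · exact ⟨0, Submodule.zero_mem _, homog_zero d, by simp, by simp [h0]⟩
    have hc0 : g.leadingCoeff ≠ 0 := by simpa using h0
    have hdvd := hlead g hg d hgd h0
    have hcoeff (j : ℕ) (hj : g.natDegree + j ≠ d) : g.leadingCoeff.coeff j = 0 := hgd _ j hj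
    have hid : g.natDegree ≤ d := by
      by_contra h
      exact hc0 (by ext j; simpa using hcoeff j (by omega))
    have hin : g.natDegree < n + 1 := (natDegree_lt_iff_degree_lt h0).2 hgn
    have hmem : C g.leadingCoeff * cellSeq μ ν g.natDegree ∈ I := by
      obtain ⟨e, he⟩ := hdvd
      rw [he, mul_comm (X ^ _) e, C_mul, mul_assoc]
      exact Ideal.mul_mem_left _ _ (hI _ hin)
    have hhom : Homog d (C g.leadingCoeff * cellSeq μ ν g.natDegree) := by
      have := (homog_C (d := d - g.natDegree) fun j hj => hcoeff j (by omega)).mul (hQ g.natDegree)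
      rwa [Nat.sub_add_cancel hid] at this
    obtain ⟨l, hl, hld, hln, hl'⟩ := ih (fun i hi => hI i (by omega)) (Ideal.sub_mem _ hg hmem)
      (hgd.sub hhom) ((degree_sub_lead_lt (cellSeq_monic μ ν) (natDegree_cellSeq μ ν) h0).trans_le
        (Order.lt_succ_iff.1 hgn))
    refine ⟨l + monomial g.natDegree g.leadingCoeff,
      Submodule.add_mem _ hl (monomial_mem_staircase hdvd), hld.add fun i j hij => ?_, ?_, ?_⟩
    · rw [coeff_monomial]
      split_ifs with h
      · exact hcoeff j (by omega)
      · rfl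
    · refine (degree_add_le _ _).trans_lt (max_lt (hln.trans ?_) ?_)
      · exact WithBot.coe_lt_coe.2 (Nat.lt_succ_self n)
      · rw [degree_monomial _ hc0]
        exact WithBot.coe_lt_coe.2 hin
    · rw [map_add, hl', substSeq_monomial]; ring

/-- Here `e` is a single term, so either it is its own remainder or `y^δ` divides it. The remainder
thus inherits homogeneity. -/
theorem exists_add_X_pow_mul {e : k[X]} {u : ℕ} (δ : ℕ) (he : ∀ c, e.coeff c ≠ 0 → c = u) :
    ∃ r q : k[X], e = r + X ^ δ * q ∧ ∀ c, r.coeff c ≠ 0 → e.coeff c ≠ 0 ∧ c < δ := by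
  by_cases hu : u < δ
  · exact ⟨e, 0, by simp, fun c hc => ⟨hc, (he c hc).trans_lt hu⟩⟩
  · have : X ^ δ ∣ e := by
      rw [X_pow_dvd_iff]
      intro c hc
      by_contra h
      exact hu (he c h ▸ hc)
    obtain ⟨q, rfl⟩ := this
    exact ⟨0, q, by simp, fun c hc => absurd rfl hc⟩

theorem exists_cellSeq_mem {μ : ℕ → ℕ} (hμ : Antitone μ) {t : ℕ} {I : Ideal k[X][X]}
    (hlead : ∀ g ∈ I, ∀ d, Homog d g → g ≠ 0 → X ^ μ g.natDegree ∣ g.leadingCoeff)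
    (hex : ∀ i ≤ t, ∃ G ∈ I, Homog (i + μ i) G ∧ G.natDegree = i ∧ G.leadingCoeff = X ^ μ i)
    (n : ℕ) (hn : n ≤ t) : ∃ ν : ℕ → ℕ → k[X], Admissible μ ν ∧ IsLowestPart μ ν ν ∧
      ∀ i ≤ n, C (X ^ μ i) * cellSeq μ ν i ∈ I := by
  induction n with
  | zero =>
    refine ⟨fun _ _ => 0, fun i j c _ h => absurd rfl h, fun i j c _ => by simp, fun i hi => ?_⟩
    obtain ⟨G, hG, -, hG1, hG2⟩ := hex 0 (Nat.zero_le t)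
    obtain rfl : i = 0 := by omega
    rw [cellSeq_zero, mul_one, ← hG2, leadingCoeff, hG1, ← eq_C_of_natDegree_eq_zero hG1]
    exact hG
  | succ n ih =>
    obtain ⟨ν, hν, hν', hI⟩ := ih (by omega)
    obtain ⟨G, hG, hGh, hG1, hG2⟩ := hex (n + 1) hn
    have hQ (i : ℕ) : Homog i (cellSeq μ ν i) := (hasPart_cellSeq hμ hν hν' i).homog
    have hμn : μ (n + 1) ≤ μ n := hμ n.le_succ
    have hXδ : (X : k[X]) ^ (μ n - μ (n + 1)) ≠ 0 := pow_ne_zero _ X_ne_zero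
    have hG0 : G ≠ 0 := by
      rintro rfl
      simp at hG1
    -- Both products have leading term `y^(μ n) x^(n+1)`. The difference has `x`-degree at most `n`
    -- and can be divided by the polynomials already constructed.
    have hE : C (X ^ (μ n - μ (n + 1))) * G - X * (C (X ^ μ n) * cellSeq μ ν n) ∈ I :=
      Ideal.sub_mem _ (Ideal.mul_mem_left _ _ hG) (Ideal.mul_mem_left _ _ (hI n le_rfl))
    have hEh : Homog (μ n + (n + 1))
        (C (X ^ (μ n - μ (n + 1))) * G - X * (C (X ^ μ n) * cellSeq μ ν n)) := by
      refine Homog.sub ?_ ?_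
      · have := (homog_C_X_pow (μ n - μ (n + 1))).mul hGh
        rwa [show μ n - μ (n + 1) + (n + 1 + μ (n + 1)) = μ n + (n + 1) by omega] at this
      · have := homog_X.mul ((homog_C_X_pow (μ n)).mul (hQ n))
        rwa [show 1 + (μ n + n) = μ n + (n + 1) by omega] at this
    have hEd : (C (X ^ (μ n - μ (n + 1))) * G - X * (C (X ^ μ n) * cellSeq μ ν n)).degree <
        ((n + 1 : ℕ) : WithBot ℕ) := by
      have h1 : (C (X ^ (μ n - μ (n + 1))) * G).degree = ((n + 1 : ℕ) : WithBot ℕ) := by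
        rw [degree_mul, degree_C hXδ, zero_add, degree_eq_natDegree hG0, hG1]
      have h2 : (X * (C (X ^ μ n) * cellSeq μ ν n)).degree = ((n + 1 : ℕ) : WithBot ℕ) := by
        rw [degree_mul, degree_X, degree_C_mul_monic (cellSeq_monic μ ν) (natDegree_cellSeq μ ν)
          (pow_ne_zero _ X_ne_zero), add_comm]
        rfl
      rw [← h1]
      refine degree_sub_lt_left (h1.trans h2.symm) (mul_ne_zero (by simp) hG0) ?_
      rw [leadingCoeff_mul, leadingCoeff_C, hG2, leadingCoeff_mul, leadingCoeff_mul, leadingCoeff_X,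
        leadingCoeff_C, (cellSeq_monic μ ν n).leadingCoeff, one_mul, mul_one, ← pow_add,
        Nat.sub_add_cancel hμn]
    obtain ⟨l, hl, hlh, hln, hl'⟩ := exists_staircase_of_mem hQ hlead _ _
      (fun i hi => hI i (by omega)) hE hEh hEd
    choose e he using hl
    have hec (j c : ℕ) (hc : (e j).coeff c ≠ 0) : c + μ j + j = μ n + (n + 1) := by
      by_contra h
      have := hlh j (c + μ j) (by omega)
      rw [he, coeff_X_pow_mul] at this
      exact hc this
    choose r q hrq hr using fun j => exists_add_X_pow_mul (e := e j)
      (u := μ n + (n + 1) - μ j - j) (μ n - μ (n + 1)) fun c hc => by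
        have := hec j c hc
        omega
    -- The remainders modulo `y^(μ n - μ (n+1))` become the new coefficients, which secures the
    -- degree bound. The quotients `q j` are used to correct `G`.
    set ν' : ℕ → ℕ → k[X] := fun i j => if i = n then -r j else ν i j with hν'_def
    have hν'n (j : ℕ) : ν' n j = -r j := if_pos rfl
    have hν'i (i : ℕ) (hi : i ≠ n) (j : ℕ) : ν' i j = ν i j := if_neg hi
    have hQ' := cellSeq_congr (μ := μ) (ν := ν') (ν' := ν) (n := n)
      fun i hi j _ => hν'i i hi.ne j
    refine ⟨ν', fun i j c hj hc => ?_, fun i j c hj => ?_, fun i hi => ?_⟩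
    · by_cases hi : i = n
      · subst hi
        rw [hν'n, coeff_neg, neg_ne_zero] at hc
        have h1 := hr j c hc
        have h2 := hec j c h1.1
        omega
      · rw [hν'i i hi] at hc
        exact hν i j c hj hc
    · by_cases hi : i = n
      · subst hi
        split_ifs with h
        · rfl
        · by_contra hc
          rw [hν'n, coeff_neg, neg_eq_zero] at hc
          exact h (hec j c (hr j c hc).1)
      · rw [hν'i i hi]
        exact hν' i j c hj
    · rcases Nat.lt_or_ge i (n + 1) with hi' | hi'
      · rw [hQ' i (by omega)]
        exact hI i (by omega)
      obtain rfl : i = n + 1 := by omega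
      -- The identity holds after multiplication by `y^(μ n - μ (n+1))`, where it combines the
      -- division of the difference with the recursion.
      have key : C (X ^ μ (n + 1)) * cellSeq μ ν' (n + 1) =
          G - ∑ j ∈ Finset.range (n + 1), C (q j) * (C (X ^ μ j) * cellSeq μ ν j) := by
        have hX : (C (X ^ (μ n - μ (n + 1))) : k[X][X]) ≠ 0 := by simp
        refine mul_left_cancel₀ hX ?_
        have h1 := X_mul_cellSeq hμ ν' n
        rw [hQ' n le_rfl] at h1
        rw [← mul_assoc, ← C_mul, ← pow_add, Nat.sub_add_cancel hμn, ← sub_eq_of_eq_add h1, mul_sub]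
        rw [substSeq_eq_sum_range _ _ hln] at hl'
        have h2 : ∑ j ∈ Finset.range (n + 1), C (l.coeff j) * cellSeq μ ν j =
            C (X ^ (μ n - μ (n + 1))) *
              ∑ j ∈ Finset.range (n + 1), C (q j) * (C (X ^ μ j) * cellSeq μ ν j) -
            ∑ j ∈ Finset.range (n + 1), C (ν' n j * X ^ μ j) * cellSeq μ ν' j := by
          rw [Finset.mul_sum, ← Finset.sum_sub_distrib]
          refine Finset.sum_congr rfl fun j hj => ?_
          rw [hQ' j (Nat.lt_succ_iff.1 (Finset.mem_range.1 hj)), he, hrq, hν'n]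
          simp only [C_mul, C_add, C_neg]
          ring
        rw [h2] at hl'
        linear_combination hl'
      rw [key]
      exact Ideal.sub_mem _ hG (Ideal.sum_mem _ fun j hj =>
        Ideal.mul_mem_left _ _ (hI j (Nat.lt_succ_iff.1 (Finset.mem_range.1 hj))))

theorem exists_cellIdeal_eq {μ : ℕ → ℕ} (hμ : Antitone μ) {t : ℕ} (ht : ∀ i, t ≤ i → μ i = 0)
    {S : Set k[X][X]} (hS : ∀ g ∈ S, ∃ d, Homog d g)
    (hlead : ∀ g ∈ Ideal.span S, ∀ d, Homog d g → g ≠ 0 → X ^ μ g.natDegree ∣ g.leadingCoeff)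
    (hex : ∀ i ≤ t, ∃ G ∈ Ideal.span S,
      Homog (i + μ i) G ∧ G.natDegree = i ∧ G.leadingCoeff = X ^ μ i) :
    ∃ ν : ℕ → ℕ → k[X], Admissible μ ν ∧ IsLowestPart μ ν ν ∧ cellIdeal μ ν t = Ideal.span S := by
  obtain ⟨ν, hν, hν', hI⟩ := exists_cellSeq_mem hμ hlead hex t le_rfl
  have hle : cellIdeal μ ν t ≤ Ideal.span S := by
    refine Ideal.span_le.2 ?_
    rintro _ ⟨i, hi, rfl⟩
    exact hI i hi
  refine ⟨ν, hν, hν', le_antisymm hle (Ideal.span_le.2 fun g hg => ?_)⟩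
  obtain ⟨d, hd⟩ := hS g hg
  obtain ⟨l, hl, -, -, hl'⟩ := exists_staircase_of_mem
    (fun i => (hasPart_cellSeq hμ hν hν' i).homog) hlead d (g.natDegree + 1)
    (fun i _ => hle (generator_mem_cellIdeal ht hν i)) (Ideal.subset_span hg) hd
    (degree_le_natDegree.trans_lt (WithBot.coe_lt_coe.2 (Nat.lt_succ_self _)))
  exact (mem_cellIdeal hμ ht hν).2 ⟨l, hl, hl'⟩

end Existence

/-! ### From `k[y][x]` to polynomials and power series; initial forms and leading exponents -/

section Bridge

variable {k : Type*} [Field k]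

/-- The exponent vector of `x^i y^j`. -/
def expo (i j : ℕ) : Fin 2 →₀ ℕ := Finsupp.single 0 i + Finsupp.single 1 j

@[simp] theorem expo_zero (i j : ℕ) : expo i j 0 = i := by simp [expo]

@[simp] theorem expo_one (i j : ℕ) : expo i j 1 = j := by simp [expo]

theorem expo_eta (e : Fin 2 →₀ ℕ) : expo (e 0) (e 1) = e := by
  ext i; fin_cases i <;> simp

theorem exponent_ext {a b : Fin 2 →₀ ℕ} (h0 : a 0 = b 0) (h1 : a 1 = b 1) : a = b := by
  rw [← expo_eta a, ← expo_eta b, h0, h1]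

theorem degree_fin_two (e : Fin 2 →₀ ℕ) : e.degree = e 0 + e 1 := by
  rw [Finsupp.degree_eq_sum, Fin.sum_univ_two]

theorem exponent_le_iff {a b : Fin 2 →₀ ℕ} : a ≤ b ↔ a 0 ≤ b 0 ∧ a 1 ≤ b 1 := by
  rw [Finsupp.le_def, Fin.forall_fin_two]

/-- The canonical map `k[y][x] → k[x,y]`. -/
def toMvPoly : k[X][X] →+* MvPolynomial (Fin 2) k :=
  Polynomial.eval₂RingHom (Polynomial.aeval (MvPolynomial.X 1)).toRingHom (MvPolynomial.X 0)

theorem toMvPoly_X : toMvPoly (Polynomial.X : k[X][X]) = MvPolynomial.X 0 := by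
  simp [toMvPoly]

theorem toMvPoly_C (c : k[X]) :
    toMvPoly (Polynomial.C c) = Polynomial.aeval (MvPolynomial.X 1) c := by
  simp [toMvPoly]

theorem toMvPoly_monomial (i j : ℕ) (c : k) :
    toMvPoly (Polynomial.monomial i (Polynomial.monomial j c)) =
      MvPolynomial.monomial (expo i j) c := by
  rw [← Polynomial.C_mul_X_pow_eq_monomial, map_mul, map_pow, toMvPoly_X, toMvPoly_C,
    Polynomial.aeval_monomial, MvPolynomial.algebraMap_eq, mul_assoc,
    MvPolynomial.X_pow_eq_monomial, MvPolynomial.X_pow_eq_monomial, MvPolynomial.monomial_mul,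
    MvPolynomial.C_mul_monomial, mul_one, mul_one, expo, add_comm]

theorem coeff_toMvPoly (g : k[X][X]) (e : Fin 2 →₀ ℕ) :
    MvPolynomial.coeff e (toMvPoly g) = (g.coeff (e 0)).coeff (e 1) := by
  induction g using Polynomial.induction_on' with
  | add p q hp hq => simp [hp, hq]
  | monomial i c =>
    induction c using Polynomial.induction_on' with
    | add p q hp hq => simp only [map_add, MvPolynomial.coeff_add, hp, hq, Polynomial.coeff_add]
    | monomial j c =>
      rw [toMvPoly_monomial, MvPolynomial.coeff_monomial, Polynomial.coeff_monomial]
      by_cases h : expo i j = e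
      · rw [if_pos h, ← h]; simp
      · rw [if_neg h]
        split_ifs with h0
        · rw [Polynomial.coeff_monomial, if_neg]
          exact fun h1 => h (exponent_ext (by simpa using h0) (by simpa using h1))
        · simp

theorem toMvPoly_injective : Function.Injective (toMvPoly (k := k)) := by
  intro f g h
  ext i j
  have := congrArg (MvPolynomial.coeff (expo i j)) h
  simpa [coeff_toMvPoly] using this

theorem toMvPoly_surjective : Function.Surjective (toMvPoly (k := k)) := by
  intro p
  induction p using MvPolynomial.induction_on' with
  | monomial e c =>
    exact ⟨Polynomial.monomial (e 0) (Polynomial.monomial (e 1) c), by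
      rw [toMvPoly_monomial, expo_eta]⟩
  | add p q hp hq =>
    obtain ⟨f, rfl⟩ := hp
    obtain ⟨g, rfl⟩ := hq
    exact ⟨f + g, map_add _ _ _⟩

/-- The canonical map `k[y][x] → k[[x,y]]`. -/
def toPowerSeries : k[X][X] →+* MvPowerSeries (Fin 2) k :=
  (MvPolynomial.coeToMvPowerSeries.ringHom (σ := Fin 2) (R := k)).comp toMvPoly

theorem coeff_toPowerSeries (g : k[X][X]) (e : Fin 2 →₀ ℕ) :
    MvPowerSeries.coeff e (toPowerSeries g) = (g.coeff (e 0)).coeff (e 1) := by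
  rw [← coeff_toMvPoly]
  simp [toPowerSeries]

theorem map_toPowerSeries (I : Ideal k[X][X]) : I.map toPowerSeries =
    (I.map toMvPoly).map (MvPolynomial.coeToMvPowerSeries.ringHom (σ := Fin 2) (R := k)) := by
  rw [Ideal.map_map]; rfl

/-- The series `f` has no terms of degree less than `n`. -/
def SeriesOrdGE (n : ℕ) (f : MvPowerSeries (Fin 2) k) : Prop :=
  ∀ e : Fin 2 →₀ ℕ, e.degree < n → MvPowerSeries.coeff e f = 0

theorem SeriesOrdGE.mul_left {n : ℕ} {f : MvPowerSeries (Fin 2) k} (h : SeriesOrdGE n f)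
    (r : MvPowerSeries (Fin 2) k) : SeriesOrdGE n (r * f) := by
  classical
  intro e he
  rw [MvPowerSeries.coeff_mul]
  refine Finset.sum_eq_zero fun p hp => ?_
  rw [Finset.HasAntidiagonal.mem_antidiagonal] at hp
  rw [h p.2 ?_, mul_zero]
  rw [← hp, map_add] at he
  omega

theorem exists_approx (n : ℕ) (r : MvPowerSeries (Fin 2) k) :
    ∃ g : k[X][X], SeriesOrdGE n (r - toPowerSeries g) := by
  obtain ⟨g, hg⟩ := toMvPoly_surjective (MvPowerSeries.truncTotal n r)
  refine ⟨g, fun e he => ?_⟩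
  rw [map_sub, coeff_toPowerSeries, ← coeff_toMvPoly, hg, MvPowerSeries.coeff_truncTotal _ he,
    sub_self]

/-- In a combination of elements of `I` the power series multipliers may be truncated, at the cost
of an error of order `n`. -/
theorem exists_approx_of_mem_map {I : Ideal k[X][X]} {f : MvPowerSeries (Fin 2) k}
    (hf : f ∈ I.map toPowerSeries) (n : ℕ) :
    ∃ g ∈ I, SeriesOrdGE n (f - toPowerSeries g) := by
  refine Submodule.span_induction
    (p := fun f _ => ∃ g ∈ I, SeriesOrdGE n (f - toPowerSeries g)) ?_ ?_ ?_ ?_ hf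
  · rintro _ ⟨g, hg, rfl⟩
    exact ⟨g, hg, fun e _ => by rw [sub_self, map_zero]⟩
  · exact ⟨0, I.zero_mem, fun e _ => by simp⟩
  · rintro f f' - - ⟨g, hg, h⟩ ⟨g', hg', h'⟩
    refine ⟨g + g', I.add_mem hg hg', fun e he => ?_⟩
    rw [map_add, add_sub_add_comm, map_add, h e he, h' e he, add_zero]
  · rintro r f - ⟨g, hg, h⟩
    obtain ⟨ρ, hρ⟩ := exists_approx n r
    refine ⟨ρ * g, I.mul_mem_left _ hg, fun e he => ?_⟩
    have : r • f - toPowerSeries (ρ * g) =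
        r * (f - toPowerSeries g) + toPowerSeries g * (r - toPowerSeries ρ) := by
      rw [smul_eq_mul, map_mul]; ring
    rw [this, map_add, h.mul_left _ e he, hρ.mul_left _ e he, add_zero]

/-- The approximation error is a polynomial of order at least `n`, so `I` already contains it. Thus
extending to power series and contracting gives back `I`. -/
theorem mem_of_toPowerSeries_mem {I : Ideal k[X][X]} {n : ℕ} (hI : ∀ g, OrdGE n g → g ∈ I)
    {g : k[X][X]} (hg : toPowerSeries g ∈ I.map toPowerSeries) : g ∈ I := by
  obtain ⟨g', hg', h⟩ := exists_approx_of_mem_map hg n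
  rw [← sub_add_cancel g g']
  refine I.add_mem (hI _ fun i j hij => ?_) hg'
  have := h (expo i j) (by rw [degree_fin_two]; simpa using hij)
  rw [← map_sub, coeff_toPowerSeries] at this
  simpa using this

/-- The series `f` has order at least `d`, and `g` is its component of degree `d`. -/
def IsInitialPart (d : ℕ) (f : MvPowerSeries (Fin 2) k) (g : k[X][X]) : Prop :=
  Homog d g ∧ SeriesOrdGE (d + 1) (f - toPowerSeries g)

theorem IsInitialPart.coeff {d : ℕ} {f : MvPowerSeries (Fin 2) k} {g : k[X][X]}
    (h : IsInitialPart d f g) {e : Fin 2 →₀ ℕ} (he : e.degree ≤ d) :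
    MvPowerSeries.coeff e f = (g.coeff (e 0)).coeff (e 1) := by
  have := h.2 e (by omega)
  rwa [map_sub, coeff_toPowerSeries, sub_eq_zero] at this

theorem HasPart.isInitialPart {d : ℕ} {f g : k[X][X]} (h : HasPart d f g) :
    IsInitialPart d (toPowerSeries f) g := by
  refine ⟨h.1, fun e he => ?_⟩
  rw [← map_sub, coeff_toPowerSeries]
  exact h.2 _ _ (by rwa [← degree_fin_two])

theorem exists_coeff_ne_zero {d : ℕ} {g : k[X][X]} (hg : Homog d g) (h0 : g ≠ 0) :
    g.natDegree ≤ d ∧ (g.coeff g.natDegree).coeff (d - g.natDegree) ≠ 0 := by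
  have h1 : g.leadingCoeff ≠ 0 := by simpa using h0
  obtain ⟨j, hj⟩ : ∃ j, (g.coeff g.natDegree).coeff j ≠ 0 := by
    by_contra h
    push Not at h
    exact h1 (Polynomial.ext (by simpa using h))
  have hjd : g.natDegree + j = d := by
    by_contra h
    exact hj (hg _ _ h)
  refine ⟨by omega, ?_⟩
  rwa [show d - g.natDegree = j by omega]

theorem IsInitialPart.order_eq {d : ℕ} {f : MvPowerSeries (Fin 2) k} {g : k[X][X]}
    (h : IsInitialPart d f g) (h0 : g ≠ 0) : f.order = d := by
  obtain ⟨hd, hc⟩ := exists_coeff_ne_zero h.1 h0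
  have hdeg : (expo g.natDegree (d - g.natDegree)).degree = d := by
    rw [degree_fin_two]; simp; omega
  refine le_antisymm ?_ (MvPowerSeries.nat_le_order fun e he => ?_)
  · rw [← hdeg]
    refine MvPowerSeries.order_le ?_
    rw [h.coeff hdeg.le]
    simpa using hc
  · rw [h.coeff he.le]
    exact h.1 _ _ (by rw [← degree_fin_two]; omega)

theorem IsInitialPart.initialForm_eq {d : ℕ} {f : MvPowerSeries (Fin 2) k} {g : k[X][X]}
    (h : IsInitialPart d f g) (h0 : g ≠ 0) : initialForm f = toMvPoly g := by
  ext e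
  rw [initialForm, h.order_eq h0, MvPowerSeries.coeff_truncTotal_eq_ite, coeff_toMvPoly]
  split_ifs with he
  · exact h.coeff (by simpa [Nat.lt_succ_iff] using he)
  · refine (h.1 _ _ ?_).symm
    rw [← degree_fin_two]
    intro h'
    rw [h'] at he
    exact he (by simp)

theorem exists_isInitialPart {f : MvPowerSeries (Fin 2) k} (hf : f ≠ 0) :
    ∃ d g, IsInitialPart d f g ∧ g ≠ 0 := by
  obtain ⟨d, hd⟩ : ∃ d : ℕ, f.order = d :=
    ⟨_, (MvPowerSeries.ne_zero_iff_order_finite.1 hf).symm⟩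
  obtain ⟨h, -⟩ := (MvPowerSeries.order_eq_nat (f := f) (n := d)).1 hd
  obtain ⟨e, he, he'⟩ := h
  obtain ⟨g, hg⟩ := exists_approx (d + 1) f
  have hco (e : Fin 2 →₀ ℕ) (he : e.degree ≤ d) :
      (g.coeff (e 0)).coeff (e 1) = MvPowerSeries.coeff e f := by
    have := hg e (by omega)
    rw [map_sub, coeff_toPowerSeries, sub_eq_zero] at this
    exact this.symm
  refine ⟨d, part d g, ⟨fun i j hij => by rw [coeff_part, if_neg hij], fun a ha => ?_⟩, ?_⟩
  · rw [map_sub, coeff_toPowerSeries, coeff_part]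
    split_ifs with h
    · rw [hco a (by omega), sub_self]
    · rw [sub_zero, MvPowerSeries.coeff_of_lt_order]
      rw [hd]
      rw [← degree_fin_two] at h
      exact_mod_cast (show a.degree < d by omega)
  · intro h0
    have := coeff_part d g (e 0) (e 1)
    rw [← degree_fin_two, if_pos he', h0, hco e he'.le] at this
    exact he (by simpa using this.symm)

/-- After removing the common factor `x^(b 0) y^(a 1)`, the comparison is between `x^n` and `y^n`
with `n = a 0 - b 0 > 0`. -/
theorem toSyn_lt_of_lt {τ : MonomialOrder (Fin 2)}
    (hτ : τ.toSyn (Finsupp.single 1 1) < τ.toSyn (Finsupp.single 0 1)) {a b : Fin 2 →₀ ℕ}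
    (hd : a.degree = b.degree) (h : b 0 < a 0) : τ.toSyn b < τ.toSyn a := by
  rw [degree_fin_two, degree_fin_two] at hd
  have ha : a = expo (b 0) (a 1) + (a 0 - b 0) • Finsupp.single 0 1 :=
    exponent_ext (by simp; omega) (by simp)
  have hb : b = expo (b 0) (a 1) + (a 0 - b 0) • Finsupp.single 1 1 :=
    exponent_ext (by simp) (by simp; omega)
  have h1 := congrArg τ.toSyn ha
  have h2 := congrArg τ.toSyn hb
  rw [map_add, map_nsmul] at h1 h2
  rw [h1, h2]
  refine add_lt_add_right ?_ _
  exact nsmul_lt_nsmul_right (by omega) hτ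

theorem localGT_iff {τ : MonomialOrder (Fin 2)}
    (hτ : τ.toSyn (Finsupp.single 1 1) < τ.toSyn (Finsupp.single 0 1)) {a b : Fin 2 →₀ ℕ} :
    LocalGT τ a b ↔ a.degree < b.degree ∨ (a.degree = b.degree ∧ b 0 < a 0) := by
  refine or_congr_right (and_congr_right fun hd => ⟨fun h => ?_, toSyn_lt_of_lt hτ hd⟩)
  by_contra h'
  rcases (not_lt.1 h').lt_or_eq with h1 | h1
  · exact lt_asymm h (toSyn_lt_of_lt hτ hd.symm h1)
  · rw [degree_fin_two, degree_fin_two] at hd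
    rw [exponent_ext h1 (by omega)] at h
    exact lt_irrefl _ h

/-- In two variables `x > y` determines the order within each degree, so the leading exponent is
read off from the `x`-degree of the initial form. -/
theorem IsInitialPart.isLeadingExp_iff {τ : MonomialOrder (Fin 2)}
    (hτ : τ.toSyn (Finsupp.single 1 1) < τ.toSyn (Finsupp.single 0 1)) {d : ℕ}
    {f : MvPowerSeries (Fin 2) k} {g : k[X][X]} (h : IsInitialPart d f g) (h0 : g ≠ 0)
    {a : Fin 2 →₀ ℕ} : IsLeadingExp τ f a ↔ a 0 = g.natDegree ∧ a.degree = d := by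
  have key (a : Fin 2 →₀ ℕ) (ha : a 0 = g.natDegree ∧ a.degree = d) : IsLeadingExp τ f a := by
    obtain ⟨ha0, had⟩ := ha
    obtain ⟨hd, hc⟩ := exists_coeff_ne_zero h.1 h0
    have ha1 : a 1 = d - g.natDegree := by
      rw [degree_fin_two] at had; omega
    refine ⟨by rwa [h.coeff had.le, ha0, ha1], fun b hb hba => ?_⟩
    rw [localGT_iff hτ, had]
    rcases lt_or_ge d b.degree with h1 | h1
    · exact Or.inl h1
    rw [h.coeff h1] at hb
    have hbd : b 0 + b 1 = d := by
      by_contra h2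
      exact hb (h.1 _ _ h2)
    refine Or.inr ⟨by rw [degree_fin_two, hbd], lt_of_le_of_ne ?_ fun h2 => hba ?_⟩
    · rw [ha0]
      refine Polynomial.le_natDegree_of_ne_zero fun h3 => hb ?_
      rw [h3, Polynomial.coeff_zero]
    · exact exponent_ext h2 (by omega)
  refine ⟨fun ha => ?_, key a⟩
  obtain ⟨hd, -⟩ := exists_coeff_ne_zero h.1 h0
  have hdeg : (expo g.natDegree (d - g.natDegree)).degree = d := by
    rw [degree_fin_two]; simp; omega
  have h1 := key (expo g.natDegree (d - g.natDegree)) ⟨by simp, hdeg⟩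
  by_cases h2 : a = expo g.natDegree (d - g.natDegree)
  · rw [h2]; exact ⟨by simp, hdeg⟩
  · have h3 := (localGT_iff hτ).1 (ha.2 _ h1.1 (Ne.symm h2))
    have h4 := (localGT_iff hτ).1 (h1.2 _ ha.1 h2)
    omega

end Bridge

/-! ### Leading term ideals and initial ideals of the extended cell ideals -/

section Cell

variable {k : Type*} [Field k]

/-- The least exponent `j` with `x^i y^j` in the ideal `(x^t, …, x^(t-i) y^(m_i), …, y^(m_t))`. -/
def colHeight {t : ℕ} (m : Fin (t + 1) → ℕ) (i : ℕ) : ℕ := m ⟨t - i, by omega⟩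

theorem colHeight_antitone {t : ℕ} {m : Fin (t + 1) → ℕ} (hm : Monotone m) :
    Antitone (colHeight m) :=
  fun i j hij => hm (by rw [Fin.mk_le_mk]; omega)

theorem colHeight_eq_zero {t : ℕ} {m : Fin (t + 1) → ℕ} (hm0 : m 0 = 0) (i : ℕ) (hi : t ≤ i) :
    colHeight m i = 0 := by
  rw [← hm0, colHeight]
  congr 1
  exact Fin.ext (Nat.sub_eq_zero_of_le hi)

theorem mem_monomialIdeal {t : ℕ} {m : Fin (t + 1) → ℕ} (hm : Monotone m)
    {p : MvPolynomial (Fin 2) k} :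
    p ∈ monomialIdeal k m ↔ ∀ e, MvPolynomial.coeff e p ≠ 0 → colHeight m (e 0) ≤ e 1 := by
  have h : monomialIdeal k m = Ideal.span ((fun s => MvPolynomial.monomial s (1 : k)) ''
      {e | ∃ i : Fin (t + 1), e = expo (t - i) (m i)}) := by
    rw [monomialIdeal]
    congr 1
    ext p
    simp only [Set.mem_range, Set.mem_image, Set.mem_ofPred_eq]
    have (i j : ℕ) : (MvPolynomial.X 0 ^ i * MvPolynomial.X 1 ^ j : MvPolynomial (Fin 2) k) =
        MvPolynomial.monomial (expo i j) 1 := by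
      rw [MvPolynomial.X_pow_eq_monomial, MvPolynomial.X_pow_eq_monomial,
        MvPolynomial.monomial_mul, one_mul, expo]
    constructor
    · rintro ⟨i, rfl⟩
      exact ⟨_, ⟨i, rfl⟩, (this _ _).symm⟩
    · rintro ⟨_, ⟨i, rfl⟩, rfl⟩
      exact ⟨i, this _ _⟩
  rw [h, MvPolynomial.mem_ideal_span_monomial_image]
  refine forall_congr' fun e => ?_
  rw [MvPolynomial.mem_support_iff]
  refine imp_congr_right fun _ => ⟨?_, fun h => ?_⟩
  · rintro ⟨_, ⟨i, rfl⟩, hi⟩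
    rw [exponent_le_iff, expo_zero, expo_one] at hi
    refine le_trans (hm ?_) hi.2
    rw [Fin.le_def]
    change t - e 0 ≤ i
    omega
  -- Truncated subtraction also covers `e 0 > t`, where the generator of index `0` is used.
  · refine ⟨_, ⟨⟨t - e 0, by omega⟩, rfl⟩, ?_⟩
    rw [exponent_le_iff, expo_zero, expo_one]
    refine ⟨?_, h⟩
    change t - (t - e 0) ≤ e 0
    omega

theorem mem_leadingTermIdeal {τ : MonomialOrder (Fin 2)} {J : Ideal (MvPowerSeries (Fin 2) k)}
    {p : MvPolynomial (Fin 2) k} :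
    p ∈ leadingTermIdeal τ J ↔ ∀ e, MvPolynomial.coeff e p ≠ 0 →
      ∃ a, (∃ f ∈ J, IsLeadingExp τ f a) ∧ a ≤ e := by
  have h : leadingTermIdeal τ J = Ideal.span ((fun s => MvPolynomial.monomial s (1 : k)) ''
      {a | ∃ f ∈ J, IsLeadingExp τ f a}) := by
    refine le_antisymm (Ideal.span_le.2 ?_) (Ideal.span_le.2 ?_)
    · rintro _ ⟨f, hf, a, ha, rfl⟩
      have : MvPolynomial.monomial a (MvPowerSeries.coeff a f) =
          MvPolynomial.C (MvPowerSeries.coeff a f) * MvPolynomial.monomial a 1 := by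
        rw [MvPolynomial.C_mul_monomial, mul_one]
      rw [this]
      exact Ideal.mul_mem_left _ _ (Ideal.subset_span ⟨a, ⟨f, hf, ha⟩, rfl⟩)
    · rintro _ ⟨a, ⟨f, hf, ha⟩, rfl⟩
      have : MvPolynomial.monomial a 1 = MvPolynomial.C (MvPowerSeries.coeff a f)⁻¹ *
          MvPolynomial.monomial a (MvPowerSeries.coeff a f) := by
        rw [MvPolynomial.C_mul_monomial, inv_mul_cancel₀ ha.1]
      change MvPolynomial.monomial a 1 ∈ _
      rw [this]
      exact Ideal.mul_mem_left _ _ (Ideal.subset_span ⟨f, hf, a, ha, rfl⟩)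
  rw [h, MvPolynomial.mem_ideal_span_monomial_image]
  refine forall_congr' fun e => ?_
  rw [MvPolynomial.mem_support_iff]
  rfl

/-- Both ideals are monomial, so it is enough to compare the monomials they contain. -/
theorem leadingTermIdeal_eq_iff {τ : MonomialOrder (Fin 2)} {J : Ideal (MvPowerSeries (Fin 2) k)}
    {t : ℕ} {m : Fin (t + 1) → ℕ} (hm : Monotone m) :
    leadingTermIdeal τ J = monomialIdeal k m ↔
      ∀ e, (∃ a, (∃ f ∈ J, IsLeadingExp τ f a) ∧ a ≤ e) ↔ colHeight m (e 0) ≤ e 1 := by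
  constructor
  · intro h e
    have h1 : MvPolynomial.monomial e (1 : k) ∈ leadingTermIdeal τ J ↔
        MvPolynomial.monomial e (1 : k) ∈ monomialIdeal k m := by rw [h]
    rw [mem_leadingTermIdeal, mem_monomialIdeal hm] at h1
    simpa [MvPolynomial.coeff_monomial] using h1
  · intro h
    ext p
    rw [mem_leadingTermIdeal, mem_monomialIdeal hm]
    simp_rw [h]

theorem isLeadingExp_ne_zero {τ : MonomialOrder (Fin 2)} {f : MvPowerSeries (Fin 2) k}
    {a : Fin 2 →₀ ℕ} (h : IsLeadingExp τ f a) : f ≠ 0 := by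
  rintro rfl
  exact h.1 (by simp)

variable {t : ℕ} {m : Fin (t + 1) → ℕ} {ν ν' : ℕ → ℕ → k[X]}

theorem IsInitialPart.ext {d d' : ℕ} {f : MvPowerSeries (Fin 2) k} {g g' : k[X][X]}
    (h : IsInitialPart d f g) (h0 : g ≠ 0) (h' : IsInitialPart d' f g') (hdd : d = d') :
    g = g' ∧ g' ≠ 0 := by
  subst hdd
  have : g = g' := by
    ext i j
    by_cases hij : i + j = d
    · have hd : (expo i j).degree ≤ d := by rw [degree_fin_two]; simp [hij]
      have h1 := h.coeff hd
      have h2 := h'.coeff hd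
      simpa using h1.symm.trans h2
    · rw [h.1 _ _ hij, h'.1 _ _ hij]
  exact ⟨this, this ▸ h0⟩

/-- A polynomial of the ideal agreeing with `f` beyond the order of `f` has the same initial part,
and for polynomials that part is known. -/
theorem exists_isInitialPart_of_mem (hm : Monotone m) (hm0 : m 0 = 0)
    (hν : Admissible (colHeight m) ν) (hν' : IsLowestPart (colHeight m) ν ν')
    {f : MvPowerSeries (Fin 2) k}
    (hf : f ∈ (cellIdeal (colHeight m) ν t).map toPowerSeries) (hf0 : f ≠ 0) :
    ∃ d, ∃ l ∈ staircase k (colHeight m), l ≠ 0 ∧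
      IsInitialPart d f (substSeq (cellSeq (colHeight m) ν') l) := by
  obtain ⟨d, g, hg, hg0⟩ := exists_isInitialPart hf0
  obtain ⟨g', hg', h⟩ := exists_approx_of_mem_map hf (d + 1)
  have hco (i j : ℕ) (hij : i + j ≤ d) : (g'.coeff i).coeff j = (g.coeff i).coeff j := by
    have hd : (expo i j).degree ≤ d := by rw [degree_fin_two]; simpa using hij
    have h1 := h (expo i j) (by omega)
    rw [map_sub, coeff_toPowerSeries, sub_eq_zero, hg.coeff hd] at h1
    simpa using h1.symm
  have hord : OrdGE d g' := fun i j hij => by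
    rw [hco i j hij.le, hg.1 _ _ hij.ne]
  obtain ⟨l, hl, hl'⟩ := exists_homog_of_mem_cellIdeal (colHeight_antitone hm)
    (colHeight_eq_zero hm0) hν hν' hg' hord
  have hfl : IsInitialPart d f (substSeq (cellSeq (colHeight m) ν') l) := by
    refine ⟨hl'.1, fun e he => ?_⟩
    have h1 := h e he
    have h2 := hl'.isInitialPart.2 e he
    rw [← sub_add_sub_cancel f (toPowerSeries g'), map_add, h1, h2, add_zero]
  refine ⟨d, l, hl, ?_, hfl⟩
  rintro rfl
  exact (hg.ext hg0 hfl rfl).2 (map_zero _)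

theorem isInitialPart_generator (hm : Monotone m)
    (hν : Admissible (colHeight m) ν) (hν' : IsLowestPart (colHeight m) ν ν') (i : ℕ) :
    IsInitialPart (colHeight m i + i)
      (toPowerSeries (Polynomial.C (Polynomial.X ^ colHeight m i) * cellSeq (colHeight m) ν i))
      (Polynomial.C (Polynomial.X ^ colHeight m i) * cellSeq (colHeight m) ν' i) :=
  ((homog_C_X_pow _).hasPart.mul
    (hasPart_cellSeq (colHeight_antitone hm) hν hν' i)).isInitialPart

theorem generator_ne_zero (μ : ℕ → ℕ) (ν : ℕ → ℕ → k[X]) (i : ℕ) :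
    Polynomial.C (Polynomial.X ^ μ i) * cellSeq μ ν i ≠ 0 :=
  mul_ne_zero (by simp) (cellSeq_monic μ ν i).ne_zero

theorem natDegree_generator (μ : ℕ → ℕ) (ν : ℕ → ℕ → k[X]) (i : ℕ) :
    (Polynomial.C (Polynomial.X ^ μ i) * cellSeq μ ν i).natDegree = i := by
  rw [Polynomial.natDegree_C_mul (by simp), natDegree_cellSeq]

theorem leadingTermIdeal_map_cellIdeal {τ : MonomialOrder (Fin 2)}
    (hτ : τ.toSyn (Finsupp.single 1 1) < τ.toSyn (Finsupp.single 0 1)) (hm : Monotone m)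
    (hm0 : m 0 = 0) (hν : Admissible (colHeight m) ν) :
    leadingTermIdeal τ ((cellIdeal (colHeight m) ν t).map toPowerSeries) = monomialIdeal k m := by
  obtain ⟨ν', hν'⟩ := exists_lowestPart (colHeight m) ν
  rw [leadingTermIdeal_eq_iff hm]
  refine fun e => ⟨?_, fun h => ?_⟩
  · rintro ⟨a, ⟨f, hf, ha⟩, hae⟩
    obtain ⟨d, l, hl, hl0, hfl⟩ := exists_isInitialPart_of_mem hm hm0 hν hν' hf
      (isLeadingExp_ne_zero ha)
    have hQ := cellSeq_monic (colHeight m) ν'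
    have hd := natDegree_cellSeq (colHeight m) ν'
    have hl0' : substSeq (cellSeq (colHeight m) ν') l ≠ 0 := by
      rwa [Ne, LinearMap.map_eq_zero_iff _ (substSeq_injective hQ hd)]
    have hdeg : (substSeq (cellSeq (colHeight m) ν') l).natDegree = l.natDegree :=
      Polynomial.natDegree_eq_of_degree_eq (degree_substSeq hQ hd l)
    obtain ⟨ha0, had⟩ := (hfl.isLeadingExp_iff hτ hl0').1 ha
    have h1 := ha.1
    rw [hfl.coeff had.le, ha0, Polynomial.coeff_natDegree, leadingCoeff_substSeq hQ hd] at h1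
    have h2 : colHeight m (a 0) ≤ a 1 := by
      by_contra h
      refine h1 (mem_staircase'.1 hl _ _ ?_)
      rw [← hdeg, ← ha0]
      omega
    rw [exponent_le_iff] at hae
    exact (colHeight_antitone hm hae.1).trans (h2.trans hae.2)
  · refine ⟨expo (e 0) (colHeight m (e 0)), ⟨_, Ideal.mem_map_of_mem _
      (generator_mem_cellIdeal (colHeight_eq_zero hm0) hν (e 0)), ?_⟩, ?_⟩
    · rw [(isInitialPart_generator hm hν hν' (e 0)).isLeadingExp_iff hτ (generator_ne_zero _ _ _),
        natDegree_generator, degree_fin_two]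
      simp [add_comm]
    · rw [exponent_le_iff]
      simpa using h

theorem initialIdeal_map_cellIdeal (hm : Monotone m)
    (hm0 : m 0 = 0) (hν : Admissible (colHeight m) ν) (hν' : IsLowestPart (colHeight m) ν ν') :
    initialIdeal ((cellIdeal (colHeight m) ν t).map toPowerSeries) =
      (cellIdeal (colHeight m) ν' t).map toMvPoly := by
  refine le_antisymm (Ideal.span_le.2 ?_) ?_
  · rintro _ ⟨f, hf, rfl⟩
    by_cases hf0 : f = 0
    · rw [hf0, initialForm, map_zero]
      exact Ideal.zero_mem _
    obtain ⟨d, l, hl, hl0, hfl⟩ := exists_isInitialPart_of_mem hm hm0 hν hν' hf hf0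
    rw [hfl.initialForm_eq (by rwa [Ne, LinearMap.map_eq_zero_iff _ (substSeq_injective
      (cellSeq_monic (colHeight m) ν') (natDegree_cellSeq (colHeight m) ν'))])]
    exact Ideal.mem_map_of_mem _ ((mem_cellIdeal (colHeight_antitone hm) (colHeight_eq_zero hm0)
      (hν.lowestPart hν')).2 ⟨l, hl, rfl⟩)
  · rw [cellIdeal, Ideal.map_span, Ideal.span_le]
    rintro _ ⟨_, ⟨i, hi, rfl⟩, rfl⟩
    refine Ideal.subset_span ⟨_, Ideal.mem_map_of_mem _
      (generator_mem_cellIdeal (colHeight_eq_zero hm0) hν i), ?_⟩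
    exact ((isInitialPart_generator hm hν hν' i).initialForm_eq (generator_ne_zero _ _ _)).symm

theorem eq_of_map_cellIdeal_eq (hm : Monotone m) (hm0 : m 0 = 0)
    (hν : Admissible (colHeight m) ν) (hν' : Admissible (colHeight m) ν')
    (h : (cellIdeal (colHeight m) ν t).map toPowerSeries =
      (cellIdeal (colHeight m) ν' t).map toPowerSeries) (i j : ℕ) (hj : j ≤ i) :
    ν i j = ν' i j := by
  have hμ := colHeight_antitone hm
  have ht := colHeight_eq_zero hm0
  refine eq_of_cellIdeal_eq hμ ht hν hν' (le_antisymm (fun g hg => ?_) fun g hg => ?_) i j hj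
  · exact mem_of_toPowerSeries_mem (fun g hg => hg.mem_cellIdeal hμ ht hν')
      (h ▸ Ideal.mem_map_of_mem _ hg)
  · exact mem_of_toPowerSeries_mem (fun g hg => hg.mem_cellIdeal hμ ht hν)
      (h ▸ Ideal.mem_map_of_mem _ hg)

/-- As `J = J^* R`, the initial forms of `J`, viewed in `k[y][x]`, are homogeneous generators. The
leading term ideal supplies the divisibility of leading coefficients and an element with leading
term `x^i y^(μ i)` for each `i`. -/
theorem exists_eq_map_cellIdeal {τ : MonomialOrder (Fin 2)}
    (hτ : τ.toSyn (Finsupp.single 1 1) < τ.toSyn (Finsupp.single 0 1)) (hm : Monotone m)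
    (hm0 : m 0 = 0) {J : Ideal (MvPowerSeries (Fin 2) k)}
    (hJ : J ∈ homCell τ (monomialIdeal k m)) :
    ∃ ν : ℕ → ℕ → k[X], Admissible (colHeight m) ν ∧ IsLowestPart (colHeight m) ν ν ∧
      (cellIdeal (colHeight m) ν t).map toPowerSeries = J := by
  obtain ⟨hL, hJJ⟩ := hJ
  replace hL := (leadingTermIdeal_eq_iff hm).1 hL
  set S : Set k[X][X] := {g | ∃ f ∈ J, toMvPoly g = initialForm f} with hS_def
  have hSJ : (Ideal.span S).map toPowerSeries = J := by
    rw [map_toPowerSeries, Ideal.map_span]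
    conv_rhs => rw [hJJ]
    rw [initialIdeal]
    congr 2
    ext p
    constructor
    · rintro ⟨g, ⟨f, hf, hg⟩, rfl⟩
      exact ⟨f, hf, hg⟩
    · rintro ⟨f, hf, rfl⟩
      obtain ⟨g, hg⟩ := toMvPoly_surjective (initialForm f)
      exact ⟨g, ⟨f, hf, hg⟩, hg⟩
  have hS : ∀ g ∈ S, ∃ d, Homog d g := by
    rintro g ⟨f, hf, hg⟩
    by_cases hf0 : f = 0
    · rw [hf0, initialForm, map_zero, map_eq_zero_iff _ toMvPoly_injective] at hg
      exact ⟨0, hg ▸ homog_zero 0⟩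
    · obtain ⟨d, g', hg', hg0⟩ := exists_isInitialPart hf0
      rw [hg'.initialForm_eq hg0] at hg
      exact ⟨d, toMvPoly_injective hg ▸ hg'.1⟩
  refine (exists_cellIdeal_eq (colHeight_antitone hm) (colHeight_eq_zero hm0) hS
    (fun g hg d hgd hg0 => ?_) fun i hi => ?_).imp
      fun ν h => ⟨h.1, h.2.1, by rw [h.2.2, hSJ]⟩
  · obtain ⟨hd, -⟩ := exists_coeff_ne_zero hgd hg0
    have h1 := (hL (expo g.natDegree (d - g.natDegree))).1 ⟨_, ⟨toPowerSeries g,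
      hSJ ▸ Ideal.mem_map_of_mem _ hg, (hgd.hasPart.isInitialPart.isLeadingExp_iff hτ hg0).2
        ⟨by simp, by rw [degree_fin_two]; simp; omega⟩⟩, le_rfl⟩
    rw [expo_zero, expo_one] at h1
    rw [Polynomial.X_pow_dvd_iff]
    intro j hj
    exact hgd _ _ (by omega)
  · obtain ⟨a, ⟨f, hf, ha⟩, hai⟩ := (hL (expo i (colHeight m i))).2 (by simp)
    obtain ⟨d, g, hg, hg0⟩ := exists_isInitialPart (isLeadingExp_ne_zero ha)
    obtain ⟨ha0, had⟩ := (hg.isLeadingExp_iff hτ hg0).1 ha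
    rw [exponent_le_iff, expo_zero, expo_one] at hai
    rw [degree_fin_two] at had
    have hgS : g ∈ Ideal.span S := Ideal.subset_span ⟨f, hf, (hg.initialForm_eq hg0).symm⟩
    obtain ⟨hd, hc⟩ := exists_coeff_ne_zero hg.1 hg0
    set c := (g.coeff g.natDegree).coeff (d - g.natDegree) with hc_def
    have hlc : g.leadingCoeff = Polynomial.C c * Polynomial.X ^ a 1 := by
      ext j
      rw [Polynomial.coeff_C_mul, Polynomial.coeff_X_pow]
      split_ifs with hj
      · rw [mul_one, hc_def, show d - g.natDegree = j by omega, Polynomial.leadingCoeff]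
      · rw [mul_zero]
        exact hg.1 _ _ (by omega)
    -- The leading term `c x^(a 0) y^(a 1)` of `g` divides `x^i y^(μ i)`; multiply `g` by the
    -- quotient.
    refine ⟨Polynomial.C (Polynomial.C c⁻¹ * Polynomial.X ^ (colHeight m i - a 1)) *
      Polynomial.X ^ (i - a 0) * g, Ideal.mul_mem_left _ _ hgS, ?_, ?_, ?_⟩
    · have h1 : Homog (colHeight m i - a 1)
          (Polynomial.C (Polynomial.C c⁻¹ * Polynomial.X ^ (colHeight m i - a 1))) :=
        homog_C fun j hj => by
          rw [Polynomial.coeff_C_mul, Polynomial.coeff_X_pow, if_neg hj, mul_zero]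
      have h2 (n : ℕ) : Homog n (Polynomial.X ^ n : k[X][X]) := by
        induction n with
        | zero => simpa using homog_one
        | succ n ih => rw [pow_succ]; exact ih.mul homog_X
      have h3 := (h1.mul (h2 (i - a 0))).mul hg.1
      rwa [show colHeight m i - a 1 + (i - a 0) + d = i + colHeight m i by omega] at h3
    · rw [mul_assoc, Polynomial.natDegree_C_mul (by simpa using hc),
        Polynomial.natDegree_X_pow_mul _ hg0]
      omega
    · rw [Polynomial.leadingCoeff_mul, Polynomial.leadingCoeff_mul, Polynomial.leadingCoeff_C,
        Polynomial.leadingCoeff_X_pow, hlc]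
      have : (Polynomial.C c⁻¹ * Polynomial.C c : k[X]) = 1 := by
        rw [← Polynomial.C_mul, inv_mul_cancel₀ hc, Polynomial.C_1]
      calc _ = (Polynomial.C c⁻¹ * Polynomial.C c) *
            (Polynomial.X ^ (colHeight m i - a 1) * Polynomial.X ^ a 1) := by ring
        _ = _ := by rw [this, one_mul, ← pow_add, Nat.sub_add_cancel hai.2]

end Cell

/-! ### Maximal minors -/

section Minors

variable {A B : Type*} [CommRing A] [CommRing B]

theorem minorsIdeal_map {p q : ℕ} (r : ℕ) (M : Matrix (Fin p) (Fin q) A) (φ : A →+* B) :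
    minorsIdeal r (M.map φ) = (minorsIdeal r M).map φ := by
  rw [minorsIdeal, minorsIdeal, Ideal.map_span]
  congr 1
  ext z
  constructor
  · rintro ⟨f, g, rfl⟩
    exact ⟨_, ⟨f, g, rfl⟩, by rw [RingHom.map_det, RingHom.mapMatrix_apply, Matrix.submatrix_map]⟩
  · rintro ⟨_, ⟨f, g, rfl⟩, rfl⟩
    exact ⟨f, g, by rw [RingHom.map_det, RingHom.mapMatrix_apply, Matrix.submatrix_map]⟩

theorem orderEmbedding_eq_succAbove {t : ℕ} (f : Fin t ↪o Fin (t + 1)) :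
    ∃ a, f = Fin.succAboveOrderEmb a := by
  obtain ⟨a, ha⟩ : ∃ a, a ∉ Set.range f := by
    by_contra h
    push Not at h
    have := Fintype.card_le_of_surjective f h
    simp at this
  refine ⟨a, OrderEmbedding.range_inj.1 ?_⟩
  have h1 : Set.range f ⊆ Set.range (Fin.succAboveOrderEmb a) := by
    change Set.range f ⊆ Set.range a.succAbove
    rw [Fin.range_succAbove]
    exact fun x hx hxa => ha (hxa ▸ hx)
  refine Set.eq_of_subset_of_ncard_le h1 ?_
  rw [Set.ncard_range_of_injective (Fin.succAboveOrderEmb a).injective,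
    Set.ncard_range_of_injective f.injective]

theorem minorsIdeal_eq_span {t : ℕ} (M : Matrix (Fin (t + 1)) (Fin t) A) :
    minorsIdeal t M = Ideal.span {z | ∃ a : Fin (t + 1), z = (M.submatrix a.succAbove id).det} := by
  rw [minorsIdeal]
  congr 1
  ext z
  constructor
  · rintro ⟨f, g, rfl⟩
    obtain ⟨a, rfl⟩ := orderEmbedding_eq_succAbove f
    have hg : (g : Fin t → Fin t) = id := by
      have : g = RelEmbedding.refl _ := by
        rw [← OrderEmbedding.range_inj, (Finite.injective_iff_surjective.1 g.injective).range_eq]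
        exact Set.range_id.symm
      rw [this]; rfl
    exact ⟨a, by rw [hg]; rfl⟩
  · rintro ⟨a, rfl⟩
    exact ⟨Fin.succAboveOrderEmb a, RelEmbedding.refl _, rfl⟩

theorem neg_one_pow_mul_self (n : ℕ) : ((-1) ^ n * (-1) ^ n : A) = 1 := by
  rw [← mul_pow, neg_mul_neg, one_mul, one_pow]

/-- The signed maximal minor obtained by deleting the row `a`. -/
def signedMinor {t : ℕ} (M : Matrix (Fin (t + 1)) (Fin t) A) (a : Fin (t + 1)) : A :=
  (-1) ^ (a : ℕ) * (M.submatrix a.succAbove id).det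

/-- Prepend a copy of column `b` and expand the resulting zero determinant along it. -/
theorem sum_mul_signedMinor {t : ℕ} (M : Matrix (Fin (t + 1)) (Fin t) A) (b : Fin t) :
    ∑ a, M a b * signedMinor M a = 0 := by
  let M' : Matrix (Fin (t + 1)) (Fin (t + 1)) A :=
    Matrix.of fun a => Fin.cons (α := fun _ => A) (M a b) (M a)
  have h : M'.det = 0 :=
    Matrix.det_zero_of_column_eq (i := 0) (j := b.succ) (Fin.succ_ne_zero b).symm
      fun a => by simp [M']
  rw [Matrix.det_succ_column_zero] at h
  rw [← h]
  refine Finset.sum_congr rfl fun a _ => ?_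
  rw [signedMinor, mul_left_comm, ← mul_assoc]
  congr 1

theorem minorsIdeal_eq_span_signedMinor {t : ℕ} (M : Matrix (Fin (t + 1)) (Fin t) A) :
    minorsIdeal t M = Ideal.span (Set.range (signedMinor M)) := by
  rw [minorsIdeal_eq_span]
  refine le_antisymm (Ideal.span_le.2 ?_) (Ideal.span_le.2 ?_)
  · rintro _ ⟨a, rfl⟩
    have : (M.submatrix a.succAbove id).det = (-1) ^ (a : ℕ) * signedMinor M a := by
      rw [signedMinor, ← mul_assoc, neg_one_pow_mul_self, one_mul]
    rw [this]
    exact Ideal.mul_mem_left _ _ (Ideal.subset_span ⟨a, rfl⟩)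
  · rintro _ ⟨a, rfl⟩
    exact Ideal.mul_mem_left _ _ (Ideal.subset_span ⟨a, rfl⟩)

end Minors

/-! ### The minors of `H + N`, and the map from matrices to ideals -/

section Matrices

open Polynomial

variable {k : Type*} [Field k] {t : ℕ} {m : Fin (t + 1) → ℕ}

/-- The matrix `H + N` over `k[y][x]`. -/
def liftedMatrix (m : Fin (t + 1) → ℕ) (N : Matrix (Fin (t + 1)) (Fin t) k[X]) :
    Matrix (Fin (t + 1)) (Fin t) k[X][X] :=
  Matrix.of fun a b => C (N a b) +
    ((if a = b.castSucc then C (X ^ diffs m b) else 0) + if a = b.succ then (-X : k[X][X]) else 0)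

theorem liftedMatrix_map (N : Matrix (Fin (t + 1)) (Fin t) k[X]) :
    (liftedMatrix m N).map toMvPoly = deformed m N := by
  ext1 a b
  rw [deformed, Matrix.add_apply, Matrix.map_apply, Matrix.map_apply, liftedMatrix, hilbertBurch,
    Matrix.of_apply, Matrix.of_apply, map_add, toMvPoly_C, add_comm]
  congr 1
  by_cases h : a = b.castSucc
  · rw [if_pos h, if_pos h, if_neg (by rw [h]; exact b.castSucc_lt_succ.ne), add_zero, toMvPoly_C]
    simp
  · rw [if_neg h, if_neg h, zero_add]
    split_ifs
    · rw [map_neg, toMvPoly_X]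
    · rw [map_zero]

theorem minorsIdeal_deformed (N : Matrix (Fin (t + 1)) (Fin t) k[X]) :
    minorsIdeal t (deformed m N) = (minorsIdeal t (liftedMatrix m N)).map toMvPoly := by
  rw [← liftedMatrix_map, minorsIdeal_map]

theorem Phi_eq (N : Matrix (Fin (t + 1)) (Fin t) k[X]) :
    Phi m N = (minorsIdeal t (liftedMatrix m N)).map toPowerSeries := by
  rw [Phi, minorsIdeal_map, minorsIdeal_deformed, map_toPowerSeries]

/-- The row of index `t - j`. -/
def revRow (t j : ℕ) : Fin (t + 1) := ⟨t - j, by omega⟩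

/-- The column of index `t - i - 1`. -/
def revCol {i : ℕ} (hi : i < t) : Fin t := ⟨t - i - 1, by omega⟩

/-- The entries of `N`, with rows and columns numbered from the end. -/
def revEntry (N : Matrix (Fin (t + 1)) (Fin t) k[X]) (i j : ℕ) : k[X] :=
  if h : i < t then N (revRow t j) (revCol h) else 0

theorem colHeight_eq (i : ℕ) : colHeight m i = m (revRow t i) := rfl

theorem sum_rows (F : Fin (t + 1) → k[X][X]) :
    ∑ a, F a = ∑ j ∈ Finset.range (t + 1), F (revRow t j) := by
  rw [← Fin.sum_univ_eq_sum_range (fun j => F (revRow t j)), ← Equiv.sum_comp Fin.revPerm]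
  refine Finset.sum_congr rfl fun a _ => congrArg F (Fin.ext ?_)
  rw [Fin.revPerm_apply, Fin.val_rev, revRow]
  change _ = t - a
  omega

theorem diffs_eq {i : ℕ} (hi : i < t) :
    diffs m (revCol hi) = colHeight m i - colHeight m (i + 1) := by
  rw [diffs, colHeight, colHeight]
  congr 2
  exact Fin.ext (show t - i - 1 + 1 = t - i by omega)

theorem sum_diffs (hm : Monotone m) (hm0 : m 0 = 0) : ∑ b, diffs m b = m (Fin.last t) := by
  have h : ∀ n (hn : n ≤ t), ∑ b ∈ Finset.range n,
      (if h : b < t then diffs m ⟨b, h⟩ else 0) = m ⟨n, by omega⟩ := by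
    intro n
    induction n with
    | zero => intro _; simpa using hm0.symm
    | succ n ih =>
      intro hn
      rw [Finset.sum_range_succ, ih (by omega), dif_pos (by omega), diffs]
      have : m ⟨n, by omega⟩ ≤ m ⟨n + 1, by omega⟩ := hm (Fin.mk_le_mk.2 n.le_succ)
      exact Nat.add_sub_cancel' this
  rw [Fin.last, ← h t le_rfl, ← Fin.sum_univ_eq_sum_range
    (fun b => if h : b < t then diffs m ⟨b, h⟩ else 0)]
  exact Finset.sum_congr rfl fun b _ => by rw [dif_pos b.2]

/-- Without its last row the matrix is lower triangular with diagonal `y^(d_b)`, and the exponents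
telescope to `m_t`. -/
theorem signedMinor_last (hm : Monotone m) (hm0 : m 0 = 0)
    {N : Matrix (Fin (t + 1)) (Fin t) k[X]} (hN : ∀ a b, a ≤ Fin.castSucc b → N a b = 0) :
    signedMinor (liftedMatrix m N) (Fin.last t) = (-1) ^ t * C (X ^ m (Fin.last t)) := by
  have hdiag (i b : Fin t) (hib : i ≤ b) : (liftedMatrix m N) i.castSucc b =
      if i = b then C (X ^ diffs m b) else 0 := by
    rw [liftedMatrix, Matrix.of_apply, hN _ _ (by simpa using hib), C_0, zero_add,
      if_neg (c := i.castSucc = b.succ), add_zero]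
    · simp
    · intro h
      have := congrArg Fin.val h
      simp only [Fin.val_castSucc, Fin.val_succ] at this
      rw [Fin.le_def] at hib
      omega
  rw [signedMinor, Matrix.det_of_isLowerTriangular, ← sum_diffs hm hm0, ← Finset.prod_pow_eq_pow_sum,
    map_prod, Fin.val_last]
  · congr 1
    refine Finset.prod_congr rfl fun b _ => ?_
    rw [Matrix.submatrix_apply, Fin.succAbove_last, id, hdiag b b le_rfl, if_pos rfl]
  · intro i b hib
    rw [Matrix.submatrix_apply, Fin.succAbove_last, id]
    have hib' : i < b := hib
    rw [hdiag i b hib'.le, if_neg hib'.ne]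

theorem signedMinor_eq (hm : Monotone m) (hm0 : m 0 = 0)
    {N : Matrix (Fin (t + 1)) (Fin t) k[X]} (hN : ∀ a b, a ≤ Fin.castSucc b → N a b = 0) (i : ℕ)
    (hi : i ≤ t) : signedMinor (liftedMatrix m N) (revRow t i) =
      (-1) ^ t * (C (X ^ colHeight m i) * cellSeq (colHeight m) (revEntry N) i) := by
  have hμ := colHeight_antitone hm
  induction i using Nat.strong_induction_on with
  | _ i ih =>
    rcases i with _ | i
    · rw [cellSeq_zero, mul_one]
      exact signedMinor_last hm hm0 hN
    · have hi' : i < t := hi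
      -- This column has a power of `y` in row `t - (i + 1)`, `-x` in row `t - i`, and entries of
      -- `N` only in rows `t - j` with `j ≤ i`. The relation gives the next minor after cancelling
      -- that power.
      have hsum := sum_mul_signedMinor (liftedMatrix m N) (revCol hi')
      have hsucc : (revCol hi').succ = revRow t i :=
        Fin.ext (show t - i - 1 + 1 = t - i by omega)
      have hcast : (revCol hi').castSucc = revRow t (i + 1) :=
        Fin.ext (show t - i - 1 = t - (i + 1) by omega)
      simp only [liftedMatrix, Matrix.of_apply, add_mul, Finset.sum_add_distrib, ite_mul, zero_mul,
        Finset.sum_ite_eq', Finset.mem_univ, if_true, hsucc, hcast,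
        diffs_eq (m := m) hi'] at hsum
      have hsum' : ∑ a, C (N a (revCol hi')) * signedMinor (liftedMatrix m N) a =
          (-1) ^ t * ∑ j ∈ Finset.range (i + 1), C (revEntry N i j * X ^ colHeight m j) *
            cellSeq (colHeight m) (revEntry N) j := by
        rw [sum_rows, Finset.mul_sum]
        symm
        rw [← Finset.sum_subset (Finset.range_mono (show i + 1 ≤ t + 1 by omega))]
        · refine Finset.sum_congr rfl fun j hj => ?_
          rw [Finset.mem_range] at hj
          rw [ih j (by omega) (by omega), revEntry, dif_pos (by omega), C_mul]
          ring
        · intro j _ hj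
          rw [Finset.mem_range, not_lt] at hj
          rw [hN, C_0, zero_mul]
          rw [Fin.le_def]
          change t - j ≤ t - i - 1
          omega
      have hold := X_mul_cellSeq hμ (revEntry N) i
      have hXδ : (C (X ^ (colHeight m i - colHeight m (i + 1))) : k[X][X]) ≠ 0 := by simp
      refine mul_left_cancel₀ hXδ ?_
      have hpow : (C (X ^ colHeight m i) : k[X][X]) =
          C (X ^ (colHeight m i - colHeight m (i + 1))) * C (X ^ colHeight m (i + 1)) := by
        rw [← C_mul, ← pow_add, Nat.sub_add_cancel (hμ i.le_succ)]
      have h1 := ih i (by omega) (by omega)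
      simp only [liftedMatrix] at h1 hsum' ⊢
      rw [hsum', h1] at hsum
      rw [hpow] at hold hsum
      linear_combination hsum + (-1) ^ t * hold

theorem minorsIdeal_liftedMatrix (hm : Monotone m) (hm0 : m 0 = 0)
    {N : Matrix (Fin (t + 1)) (Fin t) k[X]} (hN : ∀ a b, a ≤ Fin.castSucc b → N a b = 0) :
    minorsIdeal t (liftedMatrix m N) = cellIdeal (colHeight m) (revEntry N) t := by
  rw [minorsIdeal_eq_span_signedMinor, cellIdeal]
  have hrev (a : Fin (t + 1)) : revRow t (t - a) = a :=
    Fin.ext (show t - (t - (a : ℕ)) = a by omega)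
  have hu : ((-1) ^ t * (-1) ^ t : k[X][X]) = 1 := neg_one_pow_mul_self t
  refine le_antisymm (Ideal.span_le.2 ?_) (Ideal.span_le.2 ?_)
  · rintro _ ⟨a, rfl⟩
    rw [← hrev a, signedMinor_eq hm hm0 hN _ (by omega)]
    exact Ideal.mul_mem_left _ _ (Ideal.subset_span ⟨_, by omega, rfl⟩)
  · rintro _ ⟨i, hi, rfl⟩
    have h := signedMinor_eq hm hm0 hN i hi
    have h' : C (X ^ colHeight m i) * cellSeq (colHeight m) (revEntry N) i =
        (-1) ^ t * signedMinor (liftedMatrix m N) (revRow t i) := by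
      rw [h, ← mul_assoc, hu, one_mul]
    rw [h']
    exact Ideal.mul_mem_left _ _ (Ideal.subset_span ⟨_, rfl⟩)

theorem coeff_keepDegree (u : ℤ) (p : k[X]) (c : ℕ) :
    (keepDegree u p).coeff c = if (c : ℤ) = u then p.coeff c else 0 := by
  cases u with
  | ofNat n =>
    rw [keepDegree, LinearMap.comp_apply, lcoeff_apply, coeff_monomial]
    by_cases h : n = c
    · rw [if_pos h, if_pos (by rw [h]; rfl), h]
    · rw [if_neg h, if_neg]
      intro h'
      exact h (Int.ofNat.inj h').symm
  | negSucc n =>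
    rw [keepDegree, if_neg (by omega)]
    rfl

theorem homPart_apply (N : Matrix (Fin (t + 1)) (Fin t) k[X]) (a : Fin (t + 1)) (b : Fin t) :
    homPart m N a b = keepDegree (degreeMatrix m a b) (N a b) := rfl

theorem homPart_mem {N : Matrix (Fin (t + 1)) (Fin t) k[X]} (hN : N ∈ matrixSpace k m) :
    homPart m N ∈ homMatrixSpace k m := by
  refine ⟨⟨fun a b hab => ?_, fun a b hab c hc => ?_⟩, ?_⟩
  · rw [homPart_apply, hN.1 a b hab, map_zero]
  · rw [homPart_apply, coeff_keepDegree] at hc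
    refine hN.2 a b hab c fun h => hc ?_
    rw [h, ite_self]
  · change homPart m (homPart m N) = homPart m N
    ext a b c
    rw [homPart_apply, coeff_keepDegree, homPart_apply, coeff_keepDegree]
    split_ifs <;> rfl

theorem degreeMatrix_eq {i j : ℕ} (hi : i < t) (hj : j ≤ i) :
    degreeMatrix m (revRow t j) (revCol hi) =
      colHeight m i + (i + 1) - (colHeight m j + j) := by
  have h : (revCol hi).succ = revRow t i :=
    Fin.ext (show t - i - 1 + 1 = t - i by omega)
  rw [degreeMatrix, Matrix.of_apply, h, colHeight_eq, colHeight_eq]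
  change (_ : ℤ) - _ + ((t - j : ℕ) : ℤ) - ((t - i - 1 : ℕ) : ℤ) = _
  omega

theorem castSucc_lt_revRow {i j : ℕ} (hi : i < t) (hj : j ≤ i) :
    (revCol hi).castSucc < revRow t j := by
  rw [Fin.lt_def]
  change t - i - 1 < t - j
  omega

theorem admissible_revEntry {N : Matrix (Fin (t + 1)) (Fin t) k[X]} (hN : N ∈ matrixSpace k m) :
    Admissible (colHeight m) (revEntry N) := by
  intro i j c hj hc
  rw [revEntry] at hc
  split_ifs at hc with hi
  · have h := hN.2 _ _ (castSucc_lt_revRow hi hj) c hc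
    rw [degreeMatrix_eq hi hj, diffs_eq hi] at h
    omega
  · exact absurd rfl hc

theorem isLowestPart_revEntry (N : Matrix (Fin (t + 1)) (Fin t) k[X]) :
    IsLowestPart (colHeight m) (revEntry N) (revEntry (homPart m N)) := by
  intro i j c hj
  rw [revEntry, revEntry]
  split_ifs with hi h h
  · rw [homPart_apply, coeff_keepDegree, degreeMatrix_eq hi hj, if_pos (by omega)]
  · rw [homPart_apply, coeff_keepDegree, degreeMatrix_eq hi hj, if_neg (by omega)]
  · rfl
  · rfl

theorem exists_rev_indices {a : Fin (t + 1)} {b : Fin t} (hab : Fin.castSucc b < a) :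
    ∃ (i j : ℕ) (hi : i < t), j ≤ i ∧ revRow t j = a ∧ revCol hi = b := by
  rw [Fin.lt_def, Fin.val_castSucc] at hab
  exact ⟨t - 1 - b, t - a, by omega, by omega, Fin.ext (show t - (t - (a : ℕ)) = a by omega),
    Fin.ext (show t - (t - 1 - (b : ℕ)) - 1 = b by omega)⟩

theorem eq_of_revEntry_eq {N N' : Matrix (Fin (t + 1)) (Fin t) k[X]} (hN : N ∈ matrixSpace k m)
    (hN' : N' ∈ matrixSpace k m) (h : ∀ i j, j ≤ i → revEntry N i j = revEntry N' i j) :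
    N = N' := by
  ext1 a b
  rcases le_or_gt a (Fin.castSucc b) with hab | hab
  · rw [hN.1 a b hab, hN'.1 a b hab]
  · obtain ⟨i, j, hi, hj, rfl, rfl⟩ := exists_rev_indices hab
    simpa [revEntry, hi] using h i j hj

theorem exists_revEntry_eq {ν : ℕ → ℕ → k[X]} (hm0 : m 0 = 0) (hν : Admissible (colHeight m) ν)
    (hν' : IsLowestPart (colHeight m) ν ν) :
    ∃ N ∈ homMatrixSpace k m, ∀ i j, j ≤ i → revEntry N i j = ν i j := by
  set N : Matrix (Fin (t + 1)) (Fin t) k[X] := Matrix.of fun a b =>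
    if Fin.castSucc b < a then ν (t - 1 - b) (t - a) else 0 with hN_def
  have hNν (i j : ℕ) (hj : j ≤ i) : revEntry N i j = ν i j := by
    rw [revEntry]
    split_ifs with hi
    · rw [hN_def, Matrix.of_apply, if_pos (castSucc_lt_revRow hi hj)]
      congr 1
      · exact show t - 1 - (t - i - 1) = i by omega
      · exact show t - (t - j) = j by omega
    · exact (hν.eq_zero hj (colHeight_eq_zero hm0 i (by omega))).symm
  have hentry (i j : ℕ) (hi : i < t) (hj : j ≤ i) :
      N (revRow t j) (revCol hi) = ν i j := by
    rw [← hNν i j hj, revEntry, dif_pos hi]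
  have hzero (a : Fin (t + 1)) (b : Fin t) (hab : a ≤ Fin.castSucc b) : N a b = 0 :=
    if_neg hab.not_gt
  refine ⟨N, ⟨⟨hzero, fun a b hab c hc => ?_⟩, ?_⟩, hNν⟩
  · obtain ⟨i, j, hi, hj, rfl, rfl⟩ := exists_rev_indices hab
    rw [hentry i j hi hj] at hc
    have := hν i j c hj hc
    rw [degreeMatrix_eq hi hj, diffs_eq hi]
    omega
  · change homPart m N = N
    ext a b c
    rw [homPart_apply, coeff_keepDegree]
    rcases le_or_gt a (Fin.castSucc b) with hab | hab
    · rw [hzero a b hab, coeff_zero, ite_self]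
    · obtain ⟨i, j, hi, hj, rfl, rfl⟩ := exists_rev_indices hab
      rw [hentry i j hi hj, hν' i j c hj, degreeMatrix_eq hi hj]
      split_ifs <;> first | rfl | omega

theorem cellIdeal_congr {μ : ℕ → ℕ} {ν ν' : ℕ → ℕ → k[X]}
    (h : ∀ i j, j ≤ i → ν i j = ν' i j) : cellIdeal μ ν t = cellIdeal μ ν' t := by
  have (i : ℕ) : cellSeq μ ν i = cellSeq μ ν' i :=
    cellSeq_congr (n := i) (fun i _ j hj => h i j hj) i le_rfl
  simp_rw [cellIdeal, this]

theorem Phi_eq_map_cellIdeal (hm : Monotone m) (hm0 : m 0 = 0)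
    {N : Matrix (Fin (t + 1)) (Fin t) k[X]} (hN : N ∈ matrixSpace k m) :
    Phi m N = (cellIdeal (colHeight m) (revEntry N) t).map toPowerSeries := by
  rw [Phi_eq, minorsIdeal_liftedMatrix hm hm0 hN.1]

theorem Phi_mem_groebnerCell {τ : MonomialOrder (Fin 2)}
    (hτ : τ.toSyn (Finsupp.single 1 1) < τ.toSyn (Finsupp.single 0 1)) (hm : Monotone m)
    (hm0 : m 0 = 0) {N : Matrix (Fin (t + 1)) (Fin t) k[X]} (hN : N ∈ matrixSpace k m) :
    Phi m N ∈ groebnerCell τ (monomialIdeal k m) := by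
  rw [Phi_eq_map_cellIdeal hm hm0 hN]
  exact leadingTermIdeal_map_cellIdeal hτ hm hm0 (admissible_revEntry hN)

theorem initialIdeal_Phi (hm : Monotone m) (hm0 : m 0 = 0)
    {N : Matrix (Fin (t + 1)) (Fin t) k[X]} (hN : N ∈ matrixSpace k m) :
    initialIdeal (Phi m N) = minorsIdeal t (deformed m (homPart m N)) := by
  rw [Phi_eq_map_cellIdeal hm hm0 hN, minorsIdeal_deformed,
    minorsIdeal_liftedMatrix hm hm0 (homPart_mem hN).1.1]
  exact initialIdeal_map_cellIdeal hm hm0 (admissible_revEntry hN) (isLowestPart_revEntry N)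

theorem Phi_injOn (hm : Monotone m) (hm0 : m 0 = 0) :
    Set.InjOn (Phi m) (matrixSpace k m : Set (Matrix (Fin (t + 1)) (Fin t) k[X])) := by
  intro N hN N' hN' h
  rw [Phi_eq_map_cellIdeal hm hm0 hN, Phi_eq_map_cellIdeal hm hm0 hN'] at h
  exact eq_of_revEntry_eq hN hN' (eq_of_map_cellIdeal_eq hm hm0 (admissible_revEntry hN)
    (admissible_revEntry hN') h)

/-- The extension of the initial ideal is `Φ(N^*)`, so homogeneity means `Φ(N) = Φ(N^*)`, and `Φ` is
injective on the whole matrix space. -/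
theorem Phi_mem_homCell_iff {τ : MonomialOrder (Fin 2)}
    (hτ : τ.toSyn (Finsupp.single 1 1) < τ.toSyn (Finsupp.single 0 1)) (hm : Monotone m)
    (hm0 : m 0 = 0) {N : Matrix (Fin (t + 1)) (Fin t) k[X]} (hN : N ∈ matrixSpace k m) :
    Phi m N ∈ homCell τ (monomialIdeal k m) ↔ N ∈ homMatrixSpace k m := by
  have h1 : Phi m N ∈ homCell τ (monomialIdeal k m) ↔ Phi m N = Phi m (homPart m N) := by
    rw [homCell, Set.mem_ofPred_eq, initialIdeal_Phi hm hm0 hN, ← minorsIdeal_map]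
    exact and_iff_right (Phi_mem_groebnerCell hτ hm hm0 hN)
  rw [h1]
  constructor
  · intro h
    rw [Phi_injOn hm hm0 hN (homPart_mem hN).1 h]
    exact homPart_mem hN
  · intro h
    rw [show homPart m N = N from h.2]

theorem Phi_bijOn {τ : MonomialOrder (Fin 2)}
    (hτ : τ.toSyn (Finsupp.single 1 1) < τ.toSyn (Finsupp.single 0 1)) (hm : Monotone m)
    (hm0 : m 0 = 0) : Set.BijOn (Phi m)
      (homMatrixSpace k m : Set (Matrix (Fin (t + 1)) (Fin t) k[X]))
      (homCell τ (monomialIdeal k m)) := by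
  refine ⟨fun N hN => (Phi_mem_homCell_iff hτ hm hm0 hN.1).2 hN,
    (Phi_injOn hm hm0).mono fun N hN => hN.1, fun J hJ => ?_⟩
  obtain ⟨ν, h1, h2, rfl⟩ := exists_eq_map_cellIdeal hτ hm hm0 hJ
  obtain ⟨N, hN, h⟩ := exists_revEntry_eq hm0 h1 h2
  exact ⟨N, hN, by rw [Phi_eq_map_cellIdeal hm hm0 hN.1, cellIdeal_congr h]⟩

end Matrices

/-! ### The dimension of the homogeneous cell -/

section Dimension

variable {k : Type*} [Field k] {t : ℕ} {m : Fin (t + 1) → ℕ}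

/-- The positions of the possibly nonzero entries of the matrices in `M_hom`. -/
def homPositions (m : Fin (t + 1) → ℕ) : Finset (Fin (t + 1) × Fin t) :=
  {p | p.2.castSucc < p.1 ∧ 0 ≤ degreeMatrix m p.1 p.2 ∧ degreeMatrix m p.1 p.2 < diffs m p.2}

/-- The coordinates of a matrix in `M_hom`. -/
def homCoords (k : Type*) [Field k] (m : Fin (t + 1) → ℕ) :
    homMatrixSpace k m →ₗ[k] (homPositions m → k) where
  toFun N p := (N.1 p.1.1 p.1.2).coeff (degreeMatrix m p.1.1 p.1.2).toNat
  map_add' N N' := by ext p; simp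
  map_smul' r N := by ext p; simp

theorem homCoords_bijective : Function.Bijective (homCoords k m) := by
  constructor
  · rw [← LinearMap.ker_eq_bot, LinearMap.ker_eq_bot']
    rintro ⟨N, hN, hN'⟩ h
    replace hN' : homPart m N = N := hN'
    ext a b c
    change (N a b).coeff c = 0
    by_contra hc
    rcases le_or_gt a b.castSucc with hab | hab
    · rw [hN.1 a b hab] at hc
      exact hc rfl
    · have h1 := hN.2 a b hab c hc
      have h2 := hc
      rw [← hN', homPart_apply, coeff_keepDegree] at h2
      split_ifs at h2 with h3
      · have h4 : (a, b) ∈ homPositions m := by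
          rw [homPositions, Finset.mem_filter]
          exact ⟨Finset.mem_univ _, hab, by simp only; omega, by simp only; omega⟩
        have h5 := congrFun h ⟨(a, b), h4⟩
        change (N a b).coeff (degreeMatrix m a b).toNat = 0 at h5
        rw [← h3, Int.toNat_natCast] at h5
        exact hc h5
      · exact h2 rfl
  · intro f
    set N : Matrix (Fin (t + 1)) (Fin t) k[X] := Matrix.of fun a b =>
      if h : (a, b) ∈ homPositions m then
        Polynomial.monomial (degreeMatrix m a b).toNat (f ⟨(a, b), h⟩) else 0 with hN
    have hmem (a : Fin (t + 1)) (b : Fin t) (h : (a, b) ∈ homPositions m) :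
        b.castSucc < a ∧ 0 ≤ degreeMatrix m a b ∧ degreeMatrix m a b < diffs m b :=
      (Finset.mem_filter.1 h).2
    have hcoeff (a : Fin (t + 1)) (b : Fin t) (c : ℕ) (hc : (N a b).coeff c ≠ 0) :
        (a, b) ∈ homPositions m ∧ (c : ℤ) = degreeMatrix m a b := by
      rw [hN, Matrix.of_apply] at hc
      split_ifs at hc with h
      · refine ⟨h, ?_⟩
        rw [Polynomial.coeff_monomial] at hc
        split_ifs at hc with h'
        · have := (hmem a b h).2.1
          omega
        · exact absurd rfl hc
      · exact absurd rfl hc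
    refine ⟨⟨N, ⟨fun a b hab => ?_, fun a b hab c hc => ?_⟩, ?_⟩, ?_⟩
    · ext c
      by_contra hc
      exact absurd hab (hmem a b (hcoeff a b c hc).1).1.not_ge
    · obtain ⟨h1, h2⟩ := hcoeff a b c hc
      have := hmem a b h1
      omega
    · change homPart m N = N
      ext a b c
      rw [homPart_apply, coeff_keepDegree]
      split_ifs with h
      · rfl
      · by_contra hc
        exact h (hcoeff a b c (Ne.symm hc)).2
    · ext ⟨⟨a, b⟩, h⟩
      change (N a b).coeff (degreeMatrix m a b).toNat = _
      rw [hN, Matrix.of_apply, dif_pos h, Polynomial.coeff_monomial, if_pos rfl]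

theorem finite_homMatrixSpace : Module.Finite k (homMatrixSpace k m) :=
  Module.Finite.equiv (LinearEquiv.ofBijective _ (homCoords_bijective (k := k) (m := m))).symm

theorem finrank_homMatrixSpace :
    Module.finrank k (homMatrixSpace k m) = (homPositions m).card := by
  rw [(LinearEquiv.ofBijective _ (homCoords_bijective (k := k) (m := m))).finrank_eq,
    Module.finrank_fintype_fun_eq_card, Fintype.card_coe]

/-- Monomials outside the ideal give a basis of the quotient: `φ` reads off their coefficients, and
its kernel is the degree `n` part of the ideal. -/
theorem hilbertFunction_natCast (hm : Monotone m) (n : ℕ) :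
    hilbertFunction (monomialIdeal k m) n =
      (Finset.filter (fun p => n - p < colHeight m p) (Finset.range (n + 1))).card := by
  set S := Finset.filter (fun p => n - p < colHeight m p) (Finset.range (n + 1)) with hS
  let φ : MvPolynomial.homogeneousSubmodule (Fin 2) k n →ₗ[k] (S → k) :=
    { toFun := fun f p => MvPolynomial.coeff (expo p.1 (n - p.1)) f.1
      map_add' := fun f g => by ext p; simp
      map_smul' := fun r f => by ext p; simp }
  have hker : ((monomialIdeal k m).restrictScalars k).comap
      (MvPolynomial.homogeneousSubmodule (Fin 2) k n).subtype = LinearMap.ker φ := by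
    ext ⟨f, hf⟩
    rw [Submodule.mem_comap, LinearMap.mem_ker, Submodule.restrictScalars_mem]
    change f ∈ monomialIdeal k m ↔ _
    rw [mem_monomialIdeal hm]
    constructor
    · intro h
      ext ⟨p, hp⟩
      change MvPolynomial.coeff (expo p (n - p)) f = 0
      by_contra hc
      have := h _ hc
      rw [expo_zero, expo_one] at this
      have := (Finset.mem_filter.1 hp).2
      omega
    · intro h e he
      by_contra hlt
      have hdeg : e 0 + e 1 = n := by
        rw [← degree_fin_two]
        by_contra hd
        exact he (((MvPolynomial.mem_homogeneousSubmodule n f).1 hf).coeff_eq_zero hd)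
      have hp : e 0 ∈ S := Finset.mem_filter.2 ⟨Finset.mem_range.2 (by omega), by omega⟩
      have h1 : MvPolynomial.coeff (expo (e 0) (n - e 0)) f = 0 := congrFun h ⟨e 0, hp⟩
      rw [show n - e 0 = e 1 by omega, expo_eta] at h1
      exact he h1
  have hsurj : Function.Surjective φ := by
    intro v
    refine ⟨⟨∑ p : S, MvPolynomial.monomial (expo p.1 (n - p.1)) (v p), ?_⟩, ?_⟩
    · refine Submodule.sum_mem _ fun p _ => ?_
      rw [MvPolynomial.mem_homogeneousSubmodule]
      refine MvPolynomial.isHomogeneous_monomial _ ?_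
      have := Finset.mem_range.1 (Finset.mem_filter.1 p.2).1
      rw [degree_fin_two, expo_zero, expo_one]
      omega
    · ext q
      change MvPolynomial.coeff _ (∑ p : S, _) = _
      rw [MvPolynomial.coeff_sum, Finset.sum_eq_single q]
      · rw [MvPolynomial.coeff_monomial, if_pos rfl]
      · intro p _ hpq
        rw [MvPolynomial.coeff_monomial, if_neg]
        intro h
        have := congrArg (fun e : Fin 2 →₀ ℕ => e 0) h
        simp only [expo_zero] at this
        exact hpq (Subtype.ext this)
      · intro h
        exact absurd (Finset.mem_univ _) h
  change Module.finrank k (_ ⧸ _) = _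
  rw [hker, (φ.quotKerEquivOfSurjective hsurj).finrank_eq, Module.finrank_fintype_fun_eq_card,
    Fintype.card_coe]

/-- The degree of the generator `x^p y^j` of the lex-segment ideal, `j = colHeight m p`. -/
def genDegree (m : Fin (t + 1) → ℕ) (p : ℕ) : ℤ := p + colHeight m p

theorem colHeight_succ_lt (hm : StrictMono m) {p : ℕ} (hp : p < t) :
    colHeight m (p + 1) < colHeight m p :=
  hm (by rw [Fin.mk_lt_mk]; omega)

theorem genDegree_succ_le (hm : StrictMono m) {p : ℕ} (hp : p < t) :
    genDegree m (p + 1) ≤ genDegree m p := by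
  have := colHeight_succ_lt hm hp
  rw [genDegree, genDegree]
  omega

theorem genDegree_anti (hm : StrictMono m) {p q : ℕ} (hpq : p ≤ q) (hq : q ≤ t) :
    genDegree m q ≤ genDegree m p := by
  induction q, hpq using Nat.le_induction with
  | base => exact le_rfl
  | succ q _ ih => exact (genDegree_succ_le hm (by omega)).trans (ih (by omega))

theorem genDegree_last (hm0 : m 0 = 0) : genDegree m t = t := by
  rw [genDegree, colHeight_eq_zero hm0 t le_rfl]
  simp

theorem le_genDegree (hm : StrictMono m) (hm0 : m 0 = 0) {p : ℕ} (hp : p ≤ t) :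
    t ≤ genDegree m p := by
  have := genDegree_anti hm hp le_rfl
  rwa [genDegree_last hm0] at this

/-- From degree `t - 1` on, every column `p < t` meets degree `n`, and columns `p ≥ t` have height
`0`. -/
theorem hilbertFunction_eq (hm : StrictMono m) (hm0 : m 0 = 0) {n : ℤ} (hn0 : 0 ≤ n)
    (hn : (t : ℤ) - 1 ≤ n) : hilbertFunction (monomialIdeal k m) n =
      (Finset.filter (fun p => n < genDegree m p) (Finset.range t)).card := by
  obtain ⟨n, rfl⟩ := Int.eq_ofNat_of_zero_le hn0
  rw [hilbertFunction_natCast hm.monotone]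
  congr 1
  ext p
  rw [Finset.mem_filter, Finset.mem_filter, Finset.mem_range, Finset.mem_range, genDegree]
  constructor
  · rintro ⟨h1, h2⟩
    refine ⟨?_, by omega⟩
    by_contra h3
    rw [colHeight_eq_zero hm0 p (by omega)] at h2
    omega
  · rintro ⟨h1, h2⟩
    omega

/-- All generators have degree at least `t`, so every monomial of degree `t - 2` survives. For `t =
1` the index is `-1`, where the value is `0` by convention. -/
theorem hilbertFunction_sub_two (hm : StrictMono m) (hm0 : m 0 = 0) (ht : 1 ≤ t) :
    hilbertFunction (monomialIdeal k m) ((t : ℤ) - 1 - 1) = t - 1 := by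
  rcases Nat.lt_or_ge t 2 with h | h
  · obtain rfl : t = 1 := by omega
    rfl
  · rw [show (t : ℤ) - 1 - 1 = ((t - 2 : ℕ) : ℤ) by omega, hilbertFunction_natCast hm.monotone,
      Finset.filter_true_of_mem, Finset.card_range]
    · omega
    · intro p hp
      rw [Finset.mem_range] at hp
      have := le_genDegree hm hm0 (show p ≤ t by omega)
      rw [genDegree] at this
      omega

/-- The number of the generators `x^p y^j`, `p < t`, of degree `n`. -/
def numGens (m : Fin (t + 1) → ℕ) (n : ℤ) : ℕ :=
  (Finset.filter (fun p => genDegree m p = n) (Finset.range t)).card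

theorem hilbertFunction_sub (hm : StrictMono m) (hm0 : m 0 = 0) (ht : 1 ≤ t) {n : ℤ}
    (hn : (t : ℤ) ≤ n) : (hilbertFunction (monomialIdeal k m) (n - 1) : ℤ) -
      hilbertFunction (monomialIdeal k m) n = numGens m n := by
  rw [hilbertFunction_eq hm hm0 (by omega) (by omega),
    hilbertFunction_eq hm hm0 (by omega) (by omega), numGens, sub_eq_iff_eq_add]
  norm_cast
  rw [← Finset.card_union_of_disjoint]
  · congr 1
    ext p
    simp only [Finset.mem_filter, Finset.mem_union, ← and_or_left]
    refine and_congr_right fun _ => ?_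
    omega
  · rw [Finset.disjoint_filter]
    intro p _ h
    omega

/-- With `u = g_i - g_j + 1` and `g_j ≥ g_i`, the condition `u ≥ 0` leaves `g_j - g_i ∈ {0, 1}`. If
it is `1`, then `u = 0 < d` always; if it is `0`, then `u = 1 < d` says that `g` drops right after
`i`. -/
theorem card_homPositions (hm : StrictMono m) : (homPositions m).card =
    (Finset.filter (fun p : ℕ × ℕ => genDegree m p.2 = genDegree m p.1 + 1)
      (Finset.range t ×ˢ Finset.range t)).card +
    (Finset.filter (fun p : ℕ × ℕ => p.2 ≤ p.1 ∧ genDegree m p.2 = genDegree m p.1 ∧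
      genDegree m (p.1 + 1) < genDegree m p.1) (Finset.range t ×ˢ Finset.range t)).card := by
  rw [← Finset.card_union_of_disjoint]
  · refine Finset.card_bij (fun p _ => (t - 1 - p.2, t - p.1)) ?_ ?_ ?_
    · rintro ⟨a, b⟩ h
      obtain ⟨hab, h1, h2⟩ := (Finset.mem_filter.1 h).2
      obtain ⟨i, j, hi, hj, rfl, rfl⟩ := exists_rev_indices hab
      simp only at h1 h2 ⊢
      rw [degreeMatrix_eq hi hj] at h1 h2
      rw [diffs_eq hi] at h2
      have h3 : t - 1 - ((revCol hi : Fin t) : ℕ) = i := show t - 1 - (t - i - 1) = i by omega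
      have h4 : t - ((revRow t j : Fin (t + 1)) : ℕ) = j := show t - (t - j) = j by omega
      rw [h3, h4]
      have h5 := genDegree_anti hm hj hi.le
      have h6 := colHeight_succ_lt hm hi
      simp only [Finset.mem_union, Finset.mem_filter, Finset.mem_product, Finset.mem_range]
      simp only [genDegree] at *
      omega
    · rintro ⟨a, b⟩ h ⟨a', b'⟩ h' heq
      rw [Prod.mk.injEq] at heq ⊢
      simp only at heq
      exact ⟨Fin.ext (by omega), Fin.ext (by omega)⟩
    · rintro ⟨i, j⟩ h
      simp only [Finset.mem_union, Finset.mem_filter, Finset.mem_product, Finset.mem_range] at h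
      have hi : i < t := by omega
      have hj' : j < t := by omega
      have hj : j ≤ i := by
        by_contra hij
        have := genDegree_anti hm (show i ≤ j by omega) hj'.le
        omega
      have h6 := colHeight_succ_lt hm hi
      refine ⟨(revRow t j, revCol hi), Finset.mem_filter.2 ⟨Finset.mem_univ _,
        castSucc_lt_revRow hi hj, ?_, ?_⟩, Prod.ext (show t - 1 - (t - i - 1) = i by omega)
          (show t - (t - j) = j by omega)⟩
      · rw [degreeMatrix_eq hi hj]
        simp only [genDegree] at h
        omega
      · rw [degreeMatrix_eq hi hj, diffs_eq hi]
        simp only [genDegree] at h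
        omega
  · rw [Finset.disjoint_filter]
    intro p _ h
    omega

/-- Each `j` is paired with the last index `i` of its block of equal degrees. Such an `i < t` exists
unless `g_j = t`, as that block extends to `t` itself. -/
theorem card_last_in_block (hm : StrictMono m) (hm0 : m 0 = 0) :
    (Finset.filter (fun p : ℕ × ℕ => p.2 ≤ p.1 ∧ genDegree m p.2 = genDegree m p.1 ∧
      genDegree m (p.1 + 1) < genDegree m p.1) (Finset.range t ×ˢ Finset.range t)).card +
      numGens m t = t := by
  have h : t = (Finset.filter (fun p => t < genDegree m p) (Finset.range t)).card +
      numGens m t := by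
    rw [numGens, ← Finset.card_union_of_disjoint, ← Finset.filter_or, Finset.filter_true_of_mem,
      Finset.card_range]
    · intro p hp
      exact (le_genDegree hm hm0 (Finset.mem_range.1 hp).le).lt_or_eq.imp_right Eq.symm
    · rw [Finset.disjoint_filter]
      intro p _ h
      omega
  conv_rhs => rw [h]
  congr 1
  refine Finset.card_bij (fun p _ => p.2) ?_ ?_ ?_
  · rintro ⟨i, j⟩ h
    simp only [Finset.mem_filter, Finset.mem_product, Finset.mem_range] at h ⊢
    have := le_genDegree hm hm0 (show i + 1 ≤ t by omega)
    omega
  · rintro ⟨i, j⟩ h ⟨i', j'⟩ h' heq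
    simp only [Finset.mem_filter, Finset.mem_product, Finset.mem_range] at h h' heq
    subst heq
    rw [Prod.mk.injEq]
    refine ⟨?_, rfl⟩
    rcases lt_trichotomy i i' with hlt | heq | hlt
    · have := genDegree_anti hm (show i + 1 ≤ i' by omega) (by omega)
      omega
    · exact heq
    · have := genDegree_anti hm (show i' + 1 ≤ i by omega) (by omega)
      omega
  · intro j h
    simp only [Finset.mem_filter, Finset.mem_range] at h
    -- The first drop below `g_j` marks the end of the block of `j`; one occurs because `g_t = t <
    -- g_j`.
    have hex : ∃ i, j ≤ i ∧ genDegree m (i + 1) < genDegree m j := by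
      refine ⟨t - 1, by omega, ?_⟩
      rw [show t - 1 + 1 = t by omega, genDegree_last hm0]
      exact h.2
    classical
    obtain ⟨h1, h2⟩ := Nat.find_spec hex
    set i := Nat.find hex with hi
    have hit : i < t := by
      have : i ≤ t - 1 := Nat.find_min' hex ⟨by omega, by
        rw [show t - 1 + 1 = t by omega, genDegree_last hm0]
        exact h.2⟩
      omega
    have h3 : genDegree m j ≤ genDegree m i := by
      rcases h1.lt_or_eq with hlt | heq
      · have := Nat.find_min hex (m := i - 1) (by omega)
        rw [show i - 1 + 1 = i by omega] at this
        by_contra hc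
        exact this ⟨by omega, by omega⟩
      · rw [← heq]
    have h4 := genDegree_anti hm h1 hit.le
    refine ⟨(i, j), ?_, rfl⟩
    simp only [Finset.mem_filter, Finset.mem_product, Finset.mem_range]
    omega

theorem sum_numGens_mul (hm : StrictMono m) (hm0 : m 0 = 0) {s : ℤ}
    (hs : ∀ n : ℤ, t ≤ n → (∃ p < t, n < genDegree m p) → n ≤ s) :
    (Finset.filter (fun p : ℕ × ℕ => genDegree m p.2 = genDegree m p.1 + 1)
      (Finset.range t ×ˢ Finset.range t)).card =
      ∑ n ∈ Finset.Icc (t : ℤ) s, numGens m n * numGens m (n + 1) := by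
  rw [Finset.card_eq_sum_card_fiberwise (f := fun p : ℕ × ℕ => genDegree m p.1)
    (t := Finset.Icc (t : ℤ) s)]
  · refine Finset.sum_congr rfl fun n _ => ?_
    rw [numGens, numGens, ← Finset.card_product]
    congr 1
    ext ⟨i, j⟩
    simp only [Finset.mem_filter, Finset.mem_product, Finset.mem_range]
    constructor
    · rintro ⟨⟨⟨h1, h2⟩, h3⟩, h4⟩
      exact ⟨⟨h1, h4⟩, h2, by omega⟩
    · rintro ⟨⟨h1, h4⟩, h2, h3⟩
      exact ⟨⟨⟨h1, h2⟩, by omega⟩, h4⟩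
  · rintro ⟨i, j⟩ h
    simp only [Finset.coe_filter, Finset.mem_product, Finset.mem_range, Set.mem_ofPred_eq] at h
    have h1 := le_genDegree hm hm0 (show i ≤ t by omega)
    -- If `g_i = n`, then `g_j = n + 1 > n` provides the witness that `n ≤ s`.
    exact Finset.mem_coe.2 (Finset.mem_Icc.2 ⟨h1, hs _ h1 ⟨j, h.1.2, by simp only; omega⟩⟩)

theorem finrank_homMatrixSpace_eq (hm : StrictMono m) (hm0 : m 0 = 0) (ht : 1 ≤ t) {h : ℤ → ℕ}
    (hh : h = hilbertFunction (monomialIdeal k m)) {s : ℤ} (hs : IsGreatest {i : ℤ | h i ≠ 0} s) :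
    (Module.finrank k (homMatrixSpace k m) : ℤ) =
      t + ∑ i ∈ Finset.Icc ((t : ℤ) - 1) s,
        ((h (i - 1) : ℤ) - h i) * ((h i : ℤ) - h (i + 1)) := by
  have hs' (n : ℤ) (hn0 : 0 ≤ n) (hn : (t : ℤ) - 1 ≤ n) (hex : ∃ p < t, n < genDegree m p) :
      n ≤ s := by
    obtain ⟨p, hp, hpn⟩ := hex
    refine hs.2 ?_
    change h n ≠ 0
    rw [hh, hilbertFunction_eq hm hm0 hn0 hn, Finset.card_ne_zero]
    exact ⟨p, Finset.mem_filter.2 ⟨Finset.mem_range.2 hp, hpn⟩⟩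
  have h1 : (h ((t : ℤ) - 1) : ℤ) = t := by
    rw [hh, hilbertFunction_eq hm hm0 (by omega) le_rfl, Finset.filter_true_of_mem,
      Finset.card_range]
    intro p hp
    have := le_genDegree hm hm0 (Finset.mem_range.1 hp).le
    omega
  have h2 : (h ((t : ℤ) - 1 - 1) : ℤ) = t - 1 := by
    rw [hh, hilbertFunction_sub_two hm hm0 ht]
    omega
  have hsub (n : ℤ) (hn : (t : ℤ) ≤ n) : (h (n - 1) : ℤ) - h n = numGens m n := by
    rw [hh]
    exact hilbertFunction_sub hm hm0 ht hn
  have hts : (t : ℤ) - 1 ≤ s := by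
    have := le_genDegree hm hm0 (Nat.zero_le t)
    exact hs' _ (by omega) le_rfl ⟨0, ht, by omega⟩
  have hIcc : Finset.Icc ((t : ℤ) - 1) s = insert ((t : ℤ) - 1) (Finset.Icc (t : ℤ) s) := by
    ext n
    simp only [Finset.mem_insert, Finset.mem_Icc]
    omega
  have hsum : ∑ i ∈ Finset.Icc (t : ℤ) s, ((h (i - 1) : ℤ) - h i) * ((h i : ℤ) - h (i + 1)) =
      ((∑ n ∈ Finset.Icc (t : ℤ) s, numGens m n * numGens m (n + 1) : ℕ) : ℤ) := by
    push_cast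
    refine Finset.sum_congr rfl fun n hn => ?_
    have hn' := (Finset.mem_Icc.1 hn).1
    have h3 := hsub (n + 1) (by omega)
    rw [add_sub_cancel_right] at h3
    rw [hsub n hn', h3]
  have h4 := hsub t le_rfl
  have h5 := card_last_in_block hm hm0
  -- The split-off summand `i = t - 1` equals `-1` times the number of generators `x^p y^j`, `p <
  -- t`, of degree `t`: the correction missing from the second kind of position.
  rw [hIcc, Finset.sum_insert (by rw [Finset.mem_Icc]; omega), hsum, finrank_homMatrixSpace,
    card_homPositions hm, sum_numGens_mul hm hm0 fun n hn => hs' n (by omega) (by omega), h2,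
    sub_add_cancel, h4, h1]
  push_cast
  have h6 := congrArg (Nat.cast : ℕ → ℤ) h5
  push_cast at h6
  linear_combination h6

end Dimension

end

end LexCell

theorem mainTheorem2 {k : Type*} [Field k]
    -- a term ordering with `x > y`
    (τ : MonomialOrder (Fin 2))
    (hτ : τ.toSyn (Finsupp.single 1 1) < τ.toSyn (Finsupp.single 0 1))
    -- a lex-segment ideal `L = (x^t, …, x^(t-i) y^(m_i), …, y^(m_t))`, `0 = m_0 < m_1 < … < m_t`
    (t : ℕ) (ht : 1 ≤ t) (m : Fin (t + 1) → ℕ) (hm0 : m 0 = 0) (hm : StrictMono m)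
    (L : Ideal (MvPolynomial (Fin 2) k)) (hL : L = LexCell.monomialIdeal k m)
    -- its Hilbert function `h`, and the last index `s` with `h_s ≠ 0`
    (h : ℤ → ℕ) (hh : h = LexCell.hilbertFunction L)
    (s : ℤ) (hs : IsGreatest {i : ℤ | h i ≠ 0} s) :
    -- `V_hom(L)` is an affine space of dimension `D_h`
    (Module.Finite k (LexCell.homMatrixSpace k m) ∧
      (Module.finrank k (LexCell.homMatrixSpace k m) : ℤ) =
        t + ∑ i ∈ Finset.Icc ((t : ℤ) - 1) s,
          ((h (i - 1) : ℤ) - h i) * ((h i : ℤ) - h (i + 1)) ∧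
      Set.BijOn (LexCell.Phi m) (LexCell.homMatrixSpace k m : Set _) (LexCell.homCell τ L) ∧
      ∀ N ∈ LexCell.matrixSpace k m, LexCell.Phi m N ∈ LexCell.groebnerCell τ L ∧
        (LexCell.Phi m N ∈ LexCell.homCell τ L ↔ N ∈ LexCell.homMatrixSpace k m)) ∧
    -- `J^* = I_t(H + N^*)` for `J = I_t(H + N)`, where `N ↦ N^*` projects onto that affine space
    (∀ N ∈ LexCell.matrixSpace k m,
      LexCell.homPart m N ∈ LexCell.homMatrixSpace k m ∧
      LexCell.initialIdeal (LexCell.Phi m N) =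
        LexCell.minorsIdeal t (LexCell.deformed m (LexCell.homPart m N))) := by
  subst hL
  have hm' := hm.monotone
  exact ⟨⟨LexCell.finite_homMatrixSpace, LexCell.finrank_homMatrixSpace_eq hm hm0 ht hh hs,
    LexCell.Phi_bijOn hτ hm' hm0, fun N hN => ⟨LexCell.Phi_mem_groebnerCell hτ hm' hm0 hN,
      LexCell.Phi_mem_homCell_iff hτ hm' hm0 hN⟩⟩,
    fun N hN => ⟨LexCell.homPart_mem hN, LexCell.initialIdeal_Phi hm' hm0 hN⟩⟩
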